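/- All logarithms have base $2$. Let $\mathcal X,\mathcal Y$ be finite sets, $P_{XY}$ a distribution on $\mathcal X\times\mathcal Y$, and let $(X^n,Y^n)$ be i.i.d. with law $P_{XY}$. For $R_1,R_2\in\mathbb R$ put $$F(R_1,R_2|P_{XY})=\min\Bigl\{D(P_{\tilde U\tilde X\tilde Y}\|P_{\tilde U|\tilde Y}P_{XY})+|I(\tilde U\wedge\tilde Y)-R_2|^+ \;:\; P_{\tilde U\tilde X\tilde Y}\in\mathcal P(\mathcal U\times\mathcal X\times\mathcal Y),\ H(\tilde X|\tilde U)\le R_1,\ |\mathcal U|\le|\mathcal X||\mathcal Y|+2\Bigr\},$$ where $|a|^+=\max\{a,0\}$, and the value is $+\infty$ if no such distribution exists. Let $\mathcal R_{\rm WAK}$ be the set of pairs $(R_1,R_2)$ for which there are finite sets $\mathcal M_1^{(n)},\mathcal M_2^{(n)}$, encoders $\varphi_1^{(n)}:\mathcal X^n\to\mathcal M_1^{(n)}$, $\varphi_2^{(n)}:\mathcal Y^n\to\mathcal M_2^{(n)}$ and decoders $\psi^{(n)}:\mathcal M_1^{(n)}\times\mathcal M_2^{(n)}\to\mathcal X^n$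 with $\limsup_n\frac1n\log|\mathcal M_i^{(n)}|\le R_i$ ($i=1,2$) and $\Pr\bigl(\psi^{(n)}(\varphi_1^{(n)}(X^n),\varphi_2^{(n)}(Y^n))\ne X^n\bigr)\to0$. Let $R_1,R_2\in\mathbb R$, $\delta>0$ and $R_1'=R_1+\delta$. For $n\ge1$ consider finite sets $\mathcal K_n,\mathcal S_n$ with $|\mathcal K_n|\le2^{nR_1}$ and $|\mathcal S_n|\le2^{nR_2}$, a function $g_n:\mathcal Y^n\to\mathcal S_n$, and a random map $F_n:\mathcal X^n\to\mathcal K_n$ (the hash function) that is independent of $(X^n,Y^n)$ and universal, i.e. $\Pr(F_n(x)=F_n(x'))\le1/|\mathcal K_n|$ for all $x\ne x'$ in $\mathcal X^n$. Put $K_n=F_n(X^n)$, $S_n=g_n(Y^n)$ and $$\Delta=d_{\rm var}\bigl(P_{K_nS_nF_n},\,P_{\rm unif}\times P_{S_n}\times P_{F_n}\bigr),\qquad d_{\rm var}(P,Q)=\tfrac12\sum_a|P(a)-Q(a)|,$$ where $P_{\rm unif}$ is the uniform distribution on $\mathcal K_n$. Then: 1. for all such $n,\mathcal K_n,\mathcal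 S_n,g_n,F_n$, $$\Delta\le2^{-nF(R_1',R_2|P_{XY})}+\tfrac12\sqrt{2^{-n\delta}};$$ 2. $F(R_1',R_2|P_{XY})>0$ if and only if $(R_1',R_2)\notin\mathcal R_{\rm WAK}$; 3. hence, if $(R_1',R_2)\notin\mathcal R_{\rm WAK}$, then $\Delta$ decays exponentially: there are $c,C>0$, depending only on $P_{XY},R_1,R_2,\delta$, such that $\Delta\le C\,2^{-cn}$ for all such $n,\mathcal K_n,\mathcal S_n,g_n,F_n$. -/

import Mathlib

open Filter

namespace WAK

noncomputable section

/-! Distributions on a finite set `α` are functions `p : α → ℝ` in `stdSimplex ℝ α`.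
Logarithms and exponentials have base `2`. -/

open Classical in
/-- The law of `h A` when `A` has law `p`. Marginals are instances of it. -/
def push {α β : Type*} [Fintype α] (h : α → β) (p : α → ℝ) : β → ℝ :=
  fun b => ∑ a, if h a = b then p a else 0

open Classical in
/-- The probability of the event `E` under the law `p`. -/
def prob {α : Type*} [Fintype α] (p : α → ℝ) (E : α → Prop) : ℝ :=
  ∑ a, if E a then p a else 0

/-- Total variation distance. -/
def dvar {α : Type*} [Fintype α] (p q : α → ℝ) : ℝ :=
  (1 / 2) * ∑ a, |p a - q a|

/-- Shannon entropy in bits (`0 log 0 = 0`). -/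
def entropy {α : Type*} [Fintype α] (p : α → ℝ) : ℝ :=
  ∑ a, -(p a * Real.logb 2 (p a))

/-- `H(B | A)` for `(A, B)` with joint law `p`. -/
def condEntropy {α β : Type*} [Fintype α] [Fintype β] (p : α × β → ℝ) : ℝ :=
  entropy p - entropy (push Prod.fst p)

/-- `I(A ∧ B)` for `(A, B)` with joint law `p`. -/
def mutualInfo {α β : Type*} [Fintype α] [Fintype β] (p : α × β → ℝ) : ℝ :=
  entropy (push Prod.fst p) + entropy (push Prod.snd p) - entropy p

open Classical in
/-- Kullback-Leibler divergence `D(p ‖ q)` in bits; `+∞` unless `p ≪ q`. -/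
def klBits {α : Type*} [Fintype α] (p q : α → ℝ) : EReal :=
  if ∀ a, q a = 0 → p a = 0 then ((∑ a, p a * Real.logb 2 (p a / q a) : ℝ) : EReal) else ⊤

section Exponent

variable {U X Y : Type*} [Fintype U] [Fintype X] [Fintype Y]

/-- The marginal on `U × Y` of a law on `U × X × Y`. -/
def margUY (p : U × X × Y → ℝ) : U × Y → ℝ := push (fun w => (w.1, w.2.2)) p

/-- The marginal on `U × X` of a law on `U × X × Y`. -/
def margUX (p : U × X × Y → ℝ) : U × X → ℝ := push (fun w => (w.1, w.2.1)) p

/-- The marginal on `Y` of a law on `U × X × Y`. -/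
def margY (p : U × X × Y → ℝ) : Y → ℝ := push (fun w => w.2.2) p

/-- `(u, x, y) ↦ p_{U|Y}(u|y) P(x, y)`. Where `p_Y(y) = 0` the value is `0`; there `p` itself
vanishes, so the divergence of `p` from it does not depend on this convention. -/
def condTimes (p : U × X × Y → ℝ) (P : X × Y → ℝ) : U × X × Y → ℝ :=
  fun w => margUY p (w.1, w.2.2) / margY p w.2.2 * P w.2

/-- `D(p_{UXY} ‖ p_{U|Y} P_{XY}) + |I(U ∧ Y) - R₂|⁺`. -/
def exponentCost (P : X × Y → ℝ) (R₂ : ℝ) (p : U × X × Y → ℝ) : EReal :=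
  klBits p (condTimes p P) + ((max (mutualInfo (margUY p) - R₂) 0 : ℝ) : EReal)

/-- The exponent `F(R₁, R₂ | P)`: the infimum (a minimum, by compactness) of the cost over all laws on `U × X × Y` with
`|U| ≤ |X||Y| + 2` and `H(X | U) ≤ R₁` (`+∞` if there is no such law). -/
def exponentF (P : X × Y → ℝ) (R₁ R₂ : ℝ) : EReal :=
  ⨅ (m : ℕ) (_ : m ≤ Fintype.card X * Fintype.card Y + 2)
    (p : Fin m × X × Y → ℝ) (_ : p ∈ stdSimplex ℝ (Fin m × X × Y))
    (_ : condEntropy (margUX p) ≤ R₁), exponentCost P R₂ p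

end Exponent

/-- `2 ^ (-t)`, with `2 ^ (-∞) = 0`; used for `t ≥ 0` only. -/
def twoPowNeg (t : EReal) : ℝ :=
  if t = ⊤ then 0 else (2 : ℝ) ^ (-t.toReal)

section Source

variable {X Y : Type*} [Fintype X] [Fintype Y]

/-- The law of `(Xⁿ, Yⁿ)` for i.i.d. pairs with law `P`. -/
def iid (P : X × Y → ℝ) (n : ℕ) : (Fin n → X) × (Fin n → Y) → ℝ :=
  fun w => ∏ i, P (w.1 i, w.2 i)

/-- A block code: two separate encoders and a decoder that reproduces `Xⁿ`. -/
structure Code (X Y : Type*) (n : ℕ) where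
  (m₁ m₂ : ℕ)
  enc₁ : (Fin n → X) → Fin m₁
  enc₂ : (Fin n → Y) → Fin m₂
  dec : Fin m₁ × Fin m₂ → (Fin n → X)

/-- The error probability `Pr (X̂ⁿ ≠ Xⁿ)`. -/
def Code.errorProb {n : ℕ} (c : Code X Y n) (P : X × Y → ℝ) : ℝ :=
  prob (iid P n) fun w => c.dec (c.enc₁ w.1, c.enc₂ w.2) ≠ w.1

/-- The achievable rate region `R_WAK` of the source `P`. -/
def achievableRegion (P : X × Y → ℝ) : Set (ℝ × ℝ) :=
  {R | ∃ c : (n : ℕ) → Code X Y n,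
    limsup (fun n : ℕ => ((1 / (n : ℝ) * Real.logb 2 ((c n).m₁ : ℝ) : ℝ) : EReal)) atTop
      ≤ (R.1 : EReal) ∧
    limsup (fun n : ℕ => ((1 / (n : ℝ) * Real.logb 2 ((c n).m₂ : ℝ) : ℝ) : EReal)) atTop
      ≤ (R.2 : EReal) ∧
    Tendsto (fun n => (c n).errorProb P) atTop (nhds 0)}

end Source

section PrivacyAmplification

/-- A random map `F : A → K` with law `Q` is universal: `F(a) = F(a')` with probability at most
`1 / |K|` whenever `a ≠ a'`. -/
def IsUniversalHash {A K : Type*} [Fintype A] [DecidableEq A] [Fintype K]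
    (Q : (A → K) → ℝ) : Prop :=
  ∀ a a' : A, a ≠ a' → prob Q (fun f => f a = f a') ≤ 1 / (Fintype.card K : ℝ)

variable {X Y K S : Type*} [Fintype X] [DecidableEq X] [Fintype Y] [Fintype K] [Fintype S] {n : ℕ}

/-- The joint law of `(K, S, F) = (F(Xⁿ), g(Yⁿ), F)`, where `F` has law `Q` and is independent
of `(Xⁿ, Yⁿ)`. -/
def keyLaw (P : X × Y → ℝ) (g : (Fin n → Y) → S) (Q : ((Fin n → X) → K) → ℝ) :
    K × S × ((Fin n → X) → K) → ℝ :=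
  push (fun w : ((Fin n → X) × (Fin n → Y)) × ((Fin n → X) → K) => (w.2 w.1.1, g w.1.2, w.2))
    (fun w => iid P n w.1 * Q w.2)

/-- The law `P_unif × P_S × P_F` of an ideal key. -/
def idealLaw (P : X × Y → ℝ) (g : (Fin n → Y) → S) (Q : ((Fin n → X) → K) → ℝ) :
    K × S × ((Fin n → X) → K) → ℝ :=
  fun w => 1 / (Fintype.card K : ℝ) * push (fun v => g v.2) (iid P n) w.2.1 * Q w.2.2

/-- The security criterion `Δ = d_var(P_{KSF}, P_unif × P_S × P_F)`. -/
def securityDelta (P : X × Y → ℝ) (g : (Fin n → Y) → S) (Q : ((Fin n → X) → K) → ℝ) : ℝ :=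
  dvar (keyLaw P g Q) (idealLaw P g Q)

end PrivacyAmplification

end

end WAK

/-!
By compactness and reduction of the support of `U` to at most `|X||Y| + 2` atoms, the infimum
defining `F(R₁, R₂)` is attained, so `F(R₁, R₂) ≤ 0` means that some law has cost `0`: it makes
`U - Y - X` a Markov chain over the source with `H(X | U) ≤ R₁` and `I(U ∧ Y) ≤ R₂`. Such a law
yields codes by random covering of `Yⁿ` by words `uⁿ` and random binning of `Xⁿ`.

Conversely, let the decoder see only `g(Yⁿ)` and return a list of at most `2 ^ (n R₁)` words.
Conditioning the source on the event that `Xⁿ` is on the list costs `-log Pr(event)` in divergence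
and produces a law that single-letterizes to one with `H(X | U) ≤ R₁` and total cost at most
`-(1 / n) log Pr(event)`; hence the event has probability at most `2 ^ (-n F(R₁, R₂))`. This strong
converse bounds the achievable region from outside. It also gives security: for each value `s` of
`g(Yⁿ)`, the words `x` whose joint weight `P(x, s)` is large form a list of at most
`2 ^ (n (R₁ + δ))` words, whose mass is covered by the strong converse, and the remaining words are
light enough for the leftover hash lemma.
-/

namespace WAK

noncomputable section

section Push

variable {α β γ : Type*} [Fintype α]

lemma sum_push_mul [Fintype β] (f : α → β) (p : α → ℝ) (φ : β → ℝ) :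
    ∑ b, push f p b * φ b = ∑ a, p a * φ (f a) := by
  classical
  simp only [push, Finset.sum_mul]
  rw [Finset.sum_comm]
  simp [ite_mul]

lemma sum_push [Fintype β] (f : α → β) (p : α → ℝ) : ∑ b, push f p b = ∑ a, p a := by
  simpa using sum_push_mul f p (fun _ => 1)

lemma push_nonneg (f : α → β) {p : α → ℝ} (hp : ∀ a, 0 ≤ p a) (b : β) : 0 ≤ push f p b :=
  Finset.sum_nonneg fun a _ => by split_ifs <;> simp [hp]

lemma push_mem_stdSimplex [Fintype β] (f : α → β) {p : α → ℝ} (hp : p ∈ stdSimplex ℝ α) :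
    push f p ∈ stdSimplex ℝ β :=
  ⟨push_nonneg f hp.1, (sum_push f p).trans hp.2⟩

lemma push_push [Fintype β] (g : β → γ) (f : α → β) (p : α → ℝ) :
    push g (push f p) = push (g ∘ f) p := by
  classical
  funext c
  simpa [push] using sum_push_mul f p (fun b => if g b = c then 1 else 0)

lemma push_le_push_of_fiber_subset {f : α → β} {g : α → γ} {p : α → ℝ} (hp : ∀ a, 0 ≤ p a)
    {b : β} {c : γ} (h : ∀ a, f a = b → g a = c) : push f p b ≤ push g p c := by
  refine Finset.sum_le_sum fun a _ => ?_
  by_cases ha : f a = b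
  · simp [ha, h a ha]
  · simp only [ha, if_false]
    split_ifs <;> simp [hp]

lemma push_apply_of_injective {f : α → β} (hf : Function.Injective f) (p : α → ℝ) (a : α) :
    push f p (f a) = p a := by
  classical
  simp [push, hf.eq_iff]

lemma push_id (p : α → ℝ) : push id p = p :=
  funext (push_apply_of_injective Function.injective_id p)

lemma le_push (f : α → β) {p : α → ℝ} (hp : ∀ a, 0 ≤ p a) (a : α) : p a ≤ push f p (f a) := by
  simpa only [push_id, id_eq] using
    push_le_push_of_fiber_subset (f := id) (g := f) hp (b := a) fun _ h => congrArg f h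

lemma push_pos (f : α → β) {p : α → ℝ} (hp : ∀ a, 0 ≤ p a) {a : α} (ha : p a ≠ 0) :
    0 < push f p (f a) :=
  ((hp a).lt_of_ne' ha).trans_le (le_push f hp a)

lemma push_eq_zero (f : α → β) {p : α → ℝ} {b : β} (h : ∀ a, f a = b → p a = 0) :
    push f p b = 0 :=
  Finset.sum_eq_zero fun a _ => by split_ifs with e <;> simp [h, e]

lemma exists_of_push_ne_zero {f : α → β} {p : α → ℝ} {b : β} (h : push f p b ≠ 0) :
    ∃ a, f a = b ∧ p a ≠ 0 := by
  contrapose! h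
  exact push_eq_zero f h

lemma push_fst_apply {β : Type*} [Fintype β] (p : α × β → ℝ) (a : α) :
    push Prod.fst p a = ∑ b, p (a, b) := by
  classical
  simp only [push, Fintype.sum_prod_type]
  rw [Finset.sum_comm]
  simp

lemma push_snd_apply {β : Type*} [Fintype β] (p : α × β → ℝ) (b : β) :
    push Prod.snd p b = ∑ a, p (a, b) := by
  classical
  simp [push, Fintype.sum_prod_type]

lemma push_pair_mul [Fintype β] (w : α → ℝ) (k : α → β → ℝ) (f : α → β → γ) (a : α) (c : γ) :
    push (fun v : α × β => (v.1, f v.1 v.2)) (fun v => w v.1 * k v.1 v.2) (a, c) =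
      w a * push (f a) (k a) c := by
  classical
  simp only [push, Fintype.sum_prod_type, Prod.mk.injEq, Finset.mul_sum]
  rw [Finset.sum_eq_single a (fun b _ hb => by simp [hb]) (by simp)]
  simp

lemma continuous_push (f : α → β) : Continuous fun p : α → ℝ => push f p := by
  refine continuous_pi fun b => continuous_finsetSum _ fun a _ => ?_
  split_ifs <;> fun_prop

end Push

section Prob

variable {α β : Type*} [Fintype α]

lemma prob_nonneg {p : α → ℝ} (hp : ∀ a, 0 ≤ p a) (E : α → Prop) : 0 ≤ prob p E :=
  Finset.sum_nonneg fun a _ => by split_ifs <;> simp [hp]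

lemma prob_mono_of_ne_zero {p : α → ℝ} (hp : ∀ a, 0 ≤ p a) {E F : α → Prop}
    (h : ∀ a, p a ≠ 0 → E a → F a) : prob p E ≤ prob p F := by
  refine Finset.sum_le_sum fun a _ => ?_
  by_cases ha : p a = 0
  · simp [ha]
  by_cases hE : E a
  · simp [hE, h a ha hE]
  · simp only [hE, if_false]
    split_ifs <;> simp [hp]

lemma prob_mono {p : α → ℝ} (hp : ∀ a, 0 ≤ p a) {E F : α → Prop} (h : ∀ a, E a → F a) :
    prob p E ≤ prob p F :=
  prob_mono_of_ne_zero hp fun a _ => h a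

lemma prob_or_le {p : α → ℝ} (hp : ∀ a, 0 ≤ p a) (E F : α → Prop) :
    prob p (fun a => E a ∨ F a) ≤ prob p E + prob p F := by
  rw [prob, prob, prob, ← Finset.sum_add_distrib]
  refine Finset.sum_le_sum fun a _ => ?_
  by_cases hE : E a <;> by_cases hF : F a <;> simp [hE, hF, hp a]

lemma prob_add_prob_not (p : α → ℝ) (E : α → Prop) :
    prob p E + prob p (fun a => ¬ E a) = ∑ a, p a := by
  rw [prob, prob, ← Finset.sum_add_distrib]
  refine Finset.sum_congr rfl fun a _ => ?_
  by_cases hE : E a <;> simp [hE]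

lemma prob_push [Fintype β] (f : α → β) (p : α → ℝ) (E : β → Prop) :
    prob (push f p) E = prob p (fun a => E (f a)) := by
  classical
  simpa [prob] using sum_push_mul f p (fun b => if E b then 1 else 0)

lemma prob_comp_equiv [Fintype β] (e : α ≃ β) (p : β → ℝ) (E : β → Prop) :
    prob (fun a => p (e a)) (fun a => E (e a)) = prob p E :=
  Fintype.sum_equiv e _ _ fun _ => rfl

end Prob

section RelativeEntropy

variable {α β : Type*} [Fintype α]

/-- Absolute continuity `p ≪ q` of finite measures on a finite set. -/
def AbsCont (p q : α → ℝ) : Prop := ∀ a, q a = 0 → p a = 0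

/-- The relative entropy `D(p ‖ q)` in bits as a real number, meaningful for `p ≪ q` only. -/
def relEntropy (p q : α → ℝ) : ℝ := ∑ a, p a * Real.logb 2 (p a / q a)

lemma klBits_eq_relEntropy {p q : α → ℝ} (h : AbsCont p q) : klBits p q = relEntropy p q :=
  if_pos h

lemma klBits_eq_top {p q : α → ℝ} (h : ¬ AbsCont p q) : klBits p q = ⊤ := if_neg h

lemma mul_log_div_sub_eq {x y : ℝ} (hy : y ≠ 0) :
    x * Real.log (x / y) - (x - y) = y * InformationTheory.klFun (x / y) := by
  rw [InformationTheory.klFun_apply]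
  field_simp
  ring

lemma sub_le_mul_log_div {x y : ℝ} (hx : 0 ≤ x) (hy : 0 ≤ y) (h : y = 0 → x = 0) :
    x - y ≤ x * Real.log (x / y) := by
  rcases eq_or_ne y 0 with rfl | hy0
  · simp [h]
  · have hkl := mul_nonneg hy (InformationTheory.klFun_nonneg (div_nonneg hx hy))
    linarith [mul_log_div_sub_eq (x := x) hy0]

lemma eq_of_mul_log_div_eq_sub {x y : ℝ} (hx : 0 ≤ x) (hy : 0 ≤ y) (h : y = 0 → x = 0)
    (he : x * Real.log (x / y) = x - y) : x = y := by
  rcases eq_or_ne y 0 with rfl | hy0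
  · exact h rfl
  · have hkl := mul_log_div_sub_eq (x := x) hy0
    rwa [he, sub_self, eq_comm, mul_eq_zero, or_iff_right hy0,
      InformationTheory.klFun_eq_zero_iff (div_nonneg hx hy), div_eq_one_iff_eq hy0] at hkl

lemma log_two_mul_relEntropy (p q : α → ℝ) :
    Real.log 2 * relEntropy p q = ∑ a, p a * Real.log (p a / q a) := by
  rw [relEntropy, Finset.mul_sum]
  refine Finset.sum_congr rfl fun a _ => ?_
  rw [mul_left_comm, Real.logb, mul_div_cancel₀ _ (Real.log_pos one_lt_two).ne']

theorem relEntropy_nonneg {p q : α → ℝ} (hp : ∀ a, 0 ≤ p a) (hq : ∀ a, 0 ≤ q a)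
    (h : AbsCont p q) (hs : ∑ a, q a ≤ ∑ a, p a) : 0 ≤ relEntropy p q := by
  have hterm := Finset.sum_le_sum fun a (_ : a ∈ Finset.univ) =>
    sub_le_mul_log_div (hp a) (hq a) (h a)
  rw [Finset.sum_sub_distrib, ← log_two_mul_relEntropy] at hterm
  exact nonneg_of_mul_nonneg_right (by linarith) (Real.log_pos one_lt_two)

theorem eq_of_relEntropy_nonpos {p q : α → ℝ} (hp : ∀ a, 0 ≤ p a) (hq : ∀ a, 0 ≤ q a)
    (h : AbsCont p q) (hs : ∑ a, q a ≤ ∑ a, p a) (hD : relEntropy p q ≤ 0) : p = q := by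
  have hterm := fun a (_ : a ∈ Finset.univ) => sub_le_mul_log_div (hp a) (hq a) (h a)
  have hle : ∑ a, p a * Real.log (p a / q a) ≤ 0 := by
    rw [← log_two_mul_relEntropy]
    exact mul_nonpos_of_nonneg_of_nonpos (Real.log_nonneg one_le_two) hD
  have heq : ∑ a, (p a - q a) = ∑ a, p a * Real.log (p a / q a) := by
    refine le_antisymm (Finset.sum_le_sum hterm) ?_
    rw [Finset.sum_sub_distrib]
    linarith
  rw [Finset.sum_eq_sum_iff_of_le hterm] at heq
  exact funext fun a =>
    eq_of_mul_log_div_eq_sub (hp a) (hq a) (h a) (heq a (Finset.mem_univ a)).symm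

lemma relEntropy_eq_sub_entropy {p q : α → ℝ} (h : AbsCont p q) :
    relEntropy p q = ∑ a, p a * -Real.logb 2 (q a) - entropy p := by
  rw [relEntropy, entropy, ← Finset.sum_sub_distrib]
  refine Finset.sum_congr rfl fun a _ => ?_
  by_cases ha : p a = 0
  · simp [ha]
  · rw [Real.logb_div ha (mt (h a) ha)]
    ring

lemma relEntropy_eq_neg_entropy_sub {p q : α → ℝ} (h : AbsCont p q) :
    relEntropy p q = -entropy p - ∑ a, p a * Real.logb 2 (q a) := by
  rw [relEntropy_eq_sub_entropy h]
  simp only [mul_neg, Finset.sum_neg_distrib]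
  ring

theorem entropy_push_le_crossEntropy [Fintype β] {p : α → ℝ} (hp : ∀ a, 0 ≤ p a) (f : α → β)
    {q : β → ℝ} (hq : ∀ b, 0 ≤ q b) (hac : ∀ a, p a ≠ 0 → q (f a) ≠ 0)
    (hs : ∑ b, q b ≤ ∑ a, p a) :
    entropy (push f p) ≤ ∑ a, p a * -Real.logb 2 (q (f a)) := by
  have hac' : AbsCont (push f p) q := fun b hb => by
    contrapose! hb
    obtain ⟨a, rfl, ha⟩ := exists_of_push_ne_zero hb
    exact hac a ha
  have hD := relEntropy_nonneg (push_nonneg f hp) hq hac' (hs.trans_eq (sum_push f p).symm)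
  rw [relEntropy_eq_sub_entropy hac', sum_push_mul f p fun b => -Real.logb 2 (q b)] at hD
  exact sub_nonneg.1 hD

end RelativeEntropy

section Entropy

variable {α β γ δ : Type*} [Fintype α] [Fintype β] [Fintype γ] [Fintype δ]

lemma entropy_push_eq_sum (f : α → β) (p : α → ℝ) :
    entropy (push f p) = ∑ a, p a * -Real.logb 2 (push f p (f a)) := by
  rw [← sum_push_mul f p (fun b => -Real.logb 2 (push f p b))]
  simp [entropy]

lemma entropy_push_congr {p : α → ℝ} {f : α → β} {g : α → γ}
    (h : ∀ a b, p a ≠ 0 → p b ≠ 0 → (f a = f b ↔ g a = g b)) :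
    entropy (push f p) = entropy (push g p) := by
  classical
  rw [entropy_push_eq_sum, entropy_push_eq_sum]
  refine Finset.sum_congr rfl fun a _ => ?_
  by_cases ha : p a = 0
  · simp [ha]
  congr 3
  refine Finset.sum_congr rfl fun b _ => ?_
  by_cases hb : p b = 0
  · simp [hb]
  · simp [h b a hb ha]

lemma entropy_push_of_injective {f : α → β} (hf : Function.Injective f) (p : α → ℝ) :
    entropy (push f p) = entropy p := by
  rw [entropy_push_congr (f := f) (g := id) fun _ _ _ _ => hf.eq_iff, push_id]

lemma entropy_push_const {p : α → ℝ} (hp : ∑ a, p a = 1) (b : β) :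
    entropy (push (fun _ => b) p) = 0 := by
  simp [entropy_push_eq_sum, push, hp]

lemma sum_mul_div_le {r : β × δ → ℝ} {s : γ × δ → ℝ} {t : δ → ℝ} (ht : ∀ d, 0 ≤ t d)
    (hr : push Prod.snd r = t) (hs : push Prod.snd s = t) :
    ∑ w : β × γ × δ, r (w.1, w.2.2) * s (w.2.1, w.2.2) / t w.2.2 ≤ ∑ d, t d := by
  calc ∑ w : β × γ × δ, r (w.1, w.2.2) * s (w.2.1, w.2.2) / t w.2.2
      = ∑ c, ∑ d, (∑ b, r (b, d)) * s (c, d) / t d := by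
        rw [Fintype.sum_prod_type, Finset.sum_comm, Fintype.sum_prod_type]
        simp only [Finset.sum_mul, Finset.sum_div]
    _ = ∑ d, t d * t d / t d := by
        rw [Finset.sum_comm]
        simp only [← push_snd_apply, hr, hs, ← Finset.sum_div, ← Finset.mul_sum]
    _ ≤ ∑ d, t d := Finset.sum_le_sum fun d _ => div_le_of_le_mul₀ (ht d) (ht d) le_rfl

theorem entropy_submodular {p : α → ℝ} (hp : ∀ a, 0 ≤ p a) (f : α → β) (g : α → γ) (h : α → δ) :
    entropy (push (fun a => (f a, g a, h a)) p) + entropy (push h p) ≤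
      entropy (push (fun a => (f a, h a)) p) + entropy (push (fun a => (g a, h a)) p) := by
  set r := push (fun a => (f a, h a)) p with hr
  set s := push (fun a => (g a, h a)) p with hs
  set t := push h p with ht
  have hr0 : ∀ a, p a ≠ 0 → r (f a, h a) ≠ 0 := fun a ha => (push_pos _ hp ha).ne'
  have hs0 : ∀ a, p a ≠ 0 → s (g a, h a) ≠ 0 := fun a ha => (push_pos _ hp ha).ne'
  have ht0 : ∀ a, p a ≠ 0 → t (h a) ≠ 0 := fun a ha => (push_pos h hp ha).ne'
  -- The right-hand side is the cross entropy relative to the law under which `f` and `g` are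
  -- conditionally independent given `h`.
  have hcross := entropy_push_le_crossEntropy hp (fun a => (f a, g a, h a))
    (q := fun w => r (w.1, w.2.2) * s (w.2.1, w.2.2) / t w.2.2)
    (fun w => div_nonneg (mul_nonneg (push_nonneg _ hp _) (push_nonneg _ hp _))
      (push_nonneg _ hp _))
    (fun a ha => div_ne_zero (mul_ne_zero (hr0 a ha) (hs0 a ha)) (ht0 a ha))
    ((sum_mul_div_le (push_nonneg h hp) (push_push _ _ _) (push_push _ _ _)).trans_eq
      (sum_push h p))
  rw [hr, hs, ht, entropy_push_eq_sum h, entropy_push_eq_sum fun a => (f a, h a),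
    entropy_push_eq_sum fun a => (g a, h a), ← le_sub_iff_add_le, ← Finset.sum_add_distrib,
    ← Finset.sum_sub_distrib]
  refine hcross.trans_eq (Finset.sum_congr rfl fun a _ => ?_)
  by_cases ha : p a = 0
  · simp [ha]
  rw [Real.logb_div (mul_ne_zero (hr0 a ha) (hs0 a ha)) (ht0 a ha),
    Real.logb_mul (hr0 a ha) (hs0 a ha)]
  ring

lemma entropy_push_le_of_factors {p : α → ℝ} (hp : ∀ a, 0 ≤ p a) {f : α → β} {g : α → γ}
    (h : ∀ a b, f a = f b → g a = g b) : entropy (push g p) ≤ entropy (push f p) := by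
  rw [entropy_push_eq_sum, entropy_push_eq_sum]
  refine Finset.sum_le_sum fun a _ => ?_
  by_cases ha : p a = 0
  · simp [ha]
  refine mul_le_mul_of_nonneg_left (neg_le_neg ?_) (hp a)
  exact Real.logb_le_logb_of_le one_lt_two (push_pos f hp ha)
    (push_le_push_of_fiber_subset hp fun b => h b a)

lemma entropy_push_pair_le {p : α → ℝ} (hp : p ∈ stdSimplex ℝ α) (f : α → β) (g : α → γ) :
    entropy (push (fun a => (f a, g a)) p) ≤ entropy (push f p) + entropy (push g p) := by
  have h := entropy_submodular hp.1 f g (fun _ => ())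
  rw [entropy_push_const hp.2, add_zero] at h
  convert h using 2 <;> exact entropy_push_congr fun a b _ _ => by simp

theorem entropy_push_pair_mul {w : α → ℝ} {k : α → β → ℝ} (hk : ∀ a, w a ≠ 0 → ∑ b, k a b = 1)
    (f : α → β → γ) :
    entropy (push (fun v : α × β => (v.1, f v.1 v.2)) (fun v => w v.1 * k v.1 v.2)) =
      entropy w + ∑ a, w a * entropy (push (f a) (k a)) := by
  rw [entropy, Fintype.sum_prod_type, entropy, ← Finset.sum_add_distrib]
  refine Finset.sum_congr rfl fun a _ => ?_
  simp only [push_pair_mul]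
  by_cases ha : w a = 0
  · simp [ha]
  have hlog : ∀ x : ℝ, -(w a * x * Real.logb 2 (w a * x)) =
      -(w a * Real.logb 2 (w a)) * x + w a * -(x * Real.logb 2 x) := fun x => by
    by_cases hx : x = 0
    · simp [hx]
    · rw [Real.logb_mul ha hx]
      ring
  simp only [hlog, Finset.sum_add_distrib, ← Finset.mul_sum, sum_push, hk a ha, mul_one, entropy]

theorem entropy_push_pair_sub_le {p : α → ℝ} (hp : p ∈ stdSimplex ℝ α) (f : α → β) (g : α → γ)
    {T : β → Finset γ} {c : ℝ} (hT : ∀ a, p a ≠ 0 → g a ∈ T (f a))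
    (hc : ∀ b, ((T b).card : ℝ) ≤ (2 : ℝ) ^ c) :
    entropy (push (fun a => (f a, g a)) p) - entropy (push f p) ≤ c := by
  classical
  have hpow : (0 : ℝ) < (2 : ℝ) ^ (-c) := by positivity
  have hmass : ∀ b, ∑ d, (if d ∈ T b then (2 : ℝ) ^ (-c) else 0) ≤ 1 := fun b => by
    rw [← Finset.sum_filter, Finset.sum_const, nsmul_eq_mul, Finset.filter_mem_eq_inter,
      Finset.univ_inter, Real.rpow_neg two_pos.le]
    exact mul_inv_le_one_of_le₀ (hc b) (by positivity)
  have hcross := entropy_push_le_crossEntropy hp.1 (fun a => (f a, g a))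
    (q := fun w => push f p w.1 * if w.2 ∈ T w.1 then (2 : ℝ) ^ (-c) else 0)
    (fun w => mul_nonneg (push_nonneg f hp.1 _) (by split_ifs <;> positivity))
    (fun a ha => by simp [hT a ha, hpow.ne', (push_pos f hp.1 ha).ne'])
    (by
      rw [← sum_push f p, Fintype.sum_prod_type]
      simp only [← Finset.mul_sum]
      exact Finset.sum_le_sum fun b _ =>
        mul_le_of_le_one_right (push_nonneg f hp.1 b) (hmass b))
  have hterm : ∀ a, p a * -Real.logb 2
      (push f p (f a) * if g a ∈ T (f a) then (2 : ℝ) ^ (-c) else 0) =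
      p a * -Real.logb 2 (push f p (f a)) + p a * c := fun a => by
    by_cases ha : p a = 0
    · simp [ha]
    rw [if_pos (hT a ha), Real.logb_mul (push_pos f hp.1 ha).ne' hpow.ne',
      Real.logb_rpow two_pos (by norm_num)]
    ring
  rw [Finset.sum_congr rfl fun a _ => hterm a, Finset.sum_add_distrib, ← Finset.sum_mul, hp.2,
    one_mul, ← entropy_push_eq_sum] at hcross
  linarith

lemma entropy_le_of_card_le {p : α → ℝ} (hp : p ∈ stdSimplex ℝ α) {c : ℝ}
    (hc : (Fintype.card α : ℝ) ≤ (2 : ℝ) ^ c) : entropy p ≤ c := by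
  have h := entropy_push_pair_sub_le hp (fun _ => ()) id (T := fun _ => Finset.univ) (c := c)
    (by simp) (by simpa using hc)
  rwa [entropy_push_of_injective fun a b h => by simpa using h, entropy_push_const hp.2,
    sub_zero] at h

lemma continuous_entropy : Continuous (entropy : (α → ℝ) → ℝ) := by
  refine continuous_finsetSum _ fun a _ => Continuous.neg ?_
  simp only [Real.logb, ← mul_div_assoc]
  exact (Real.continuous_mul_log.comp (continuous_apply a)).div_const _

end Entropy

section SupportReduction

variable {U E : Type*} [AddCommGroup E] [Module ℝ E]

lemma exists_linear_relation_of_finrank_lt_card [Fintype U] [FiniteDimensional ℝ E] (a : U → E)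
    {s : Finset U} (hs : Module.finrank ℝ E < s.card) :
    ∃ d : U → ℝ, d ≠ 0 ∧ (∀ u ∉ s, d u = 0) ∧ ∑ u, d u • a u = 0 := by
  classical
  have hdep : ¬ LinearIndepOn ℝ a (s : Set U) := fun h => by
    have hcard := h.fintype_card_le_finrank
    simp only [Finset.coe_sort_coe, Fintype.card_coe] at hcard
    exact hs.not_ge hcard
  obtain ⟨g, hg, u₀, hu₀, hgu₀⟩ := not_linearIndepOn_finset_iff.1 hdep
  refine ⟨fun u => if u ∈ s then g u else 0, fun h => hgu₀ ?_, fun u hu => if_neg hu, ?_⟩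
  · simpa [hu₀] using congrFun h u₀
  · simpa [ite_smul] using hg

lemma sum_eq_zero_of_sum_smul_eq_zero [Fintype U] {a : U → E} (l : E →ₗ[ℝ] ℝ)
    {d : U → ℝ} (hl : ∀ u, d u ≠ 0 → l (a u) = 1) (hd : ∑ u, d u • a u = 0) : ∑ u, d u = 0 := by
  have hsum := congrArg l hd
  rw [map_sum, map_zero] at hsum
  rw [← hsum]
  refine Finset.sum_congr rfl fun u _ => ?_
  by_cases hu : d u = 0
  · simp [hu]
  · simp [hl u hu]

lemma exists_neg_of_sum_eq_zero [Fintype U] {d : U → ℝ} (hd : d ≠ 0) (hsum : ∑ u, d u = 0) :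
    ∃ u, d u < 0 := by
  by_contra! hpos
  exact hd (funext fun u => (Finset.sum_eq_zero_iff_of_nonneg fun u _ => hpos u).1 hsum u
    (Finset.mem_univ u))

lemma exists_add_mul_nonneg_and_eq_zero [Finite U] {w d : U → ℝ} (hw : ∀ u, 0 ≤ w u)
    (hd : ∃ u, d u < 0) :
    ∃ t, 0 ≤ t ∧ (∀ u, 0 ≤ w u + t * d u) ∧ ∃ u, d u < 0 ∧ w u + t * d u = 0 := by
  cases nonempty_fintype U
  obtain ⟨u₁, hu₁⟩ := hd
  obtain ⟨u₀, hu₀, hmin⟩ := Finset.exists_min_image (Finset.univ.filter fun u => d u < 0)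
    (fun u => w u / -d u) ⟨u₁, by simpa using hu₁⟩
  have hneg : d u₀ < 0 := (Finset.mem_filter.1 hu₀).2
  have ht : 0 ≤ w u₀ / -d u₀ := div_nonneg (hw _) (by linarith)
  refine ⟨w u₀ / -d u₀, ht, fun u => ?_, u₀, hneg, ?_⟩
  · rcases lt_or_ge (d u) 0 with hu | hu
    · have hle := hmin u (by simpa using hu)
      rw [le_div_iff₀ (by linarith)] at hle
      linarith
    · exact add_nonneg (hw u) (mul_nonneg ht hu)
  · field_simp [hneg.ne]
    ring

lemma exists_smaller_support [Fintype U] [FiniteDimensional ℝ E] (a : U → E) (l : E →ₗ[ℝ] ℝ)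
    (c : U → ℝ) {w : U → ℝ} (hw : ∀ u, 0 ≤ w u) (hl : ∀ u, w u ≠ 0 → l (a u) = 1)
    (hcard : Module.finrank ℝ E < (Finset.univ.filter fun u => w u ≠ 0).card) :
    ∃ v : U → ℝ, (∀ u, 0 ≤ v u) ∧ (∀ u, w u = 0 → v u = 0) ∧
      ∑ u, v u • a u = ∑ u, w u • a u ∧ ∑ u, v u * c u ≤ ∑ u, w u * c u ∧
      ∃ u, w u ≠ 0 ∧ v u = 0 := by
  obtain ⟨d, hd, hdw, hda, hdc⟩ : ∃ d : U → ℝ, d ≠ 0 ∧ (∀ u, w u = 0 → d u = 0) ∧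
      ∑ u, d u • a u = 0 ∧ ∑ u, d u * c u ≤ 0 := by
    obtain ⟨d, hd, hdw, hda⟩ := exists_linear_relation_of_finrank_lt_card a hcard
    replace hdw : ∀ u, w u = 0 → d u = 0 := fun u hu => hdw u (by simpa using hu)
    rcases le_total (∑ u, d u * c u) 0 with h | h
    · exact ⟨d, hd, hdw, hda, h⟩
    · exact ⟨-d, by simpa using hd, by simpa using hdw, by simpa using hda, by simpa using h⟩
  have hsum := sum_eq_zero_of_sum_smul_eq_zero l (fun u hu => hl u (mt (hdw u) hu)) hda
  obtain ⟨t, ht, hnonneg, u₀, hu₀, hzero⟩ :=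
    exists_add_mul_nonneg_and_eq_zero hw (exists_neg_of_sum_eq_zero hd hsum)
  refine ⟨fun u => w u + t * d u, hnonneg, fun u hu => by simp [hu, hdw u hu], ?_, ?_, u₀,
    fun h => hu₀.ne (hdw u₀ h), hzero⟩
  · simp only [add_smul, mul_smul, Finset.sum_add_distrib, ← Finset.smul_sum, hda, smul_zero,
      add_zero]
  · simp only [add_mul, mul_assoc, Finset.sum_add_distrib, ← Finset.mul_sum]
    linarith [mul_nonpos_of_nonneg_of_nonpos ht hdc]

/-- A conic Carathéodory theorem with an objective. Since `l (a u) = 1` fixes the total mass, every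
linear relation among the `a u` has a negative entry, and moving along it, in the direction in
which the objective does not increase, eventually kills an atom. -/
theorem exists_weights_card_support_le_finrank [Fintype U] [FiniteDimensional ℝ E] (a : U → E)
    (l : E →ₗ[ℝ] ℝ) (c : U → ℝ) {w : U → ℝ} (hw : ∀ u, 0 ≤ w u) (hl : ∀ u, w u ≠ 0 → l (a u) = 1) :
    ∃ v : U → ℝ, (∀ u, 0 ≤ v u) ∧ (∀ u, w u = 0 → v u = 0) ∧
      ∑ u, v u • a u = ∑ u, w u • a u ∧ ∑ u, v u * c u ≤ ∑ u, w u * c u ∧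
      (Finset.univ.filter fun u => v u ≠ 0).card ≤ Module.finrank ℝ E := by
  induction hN : (Finset.univ.filter fun u => w u ≠ 0).card using Nat.strong_induction_on
    generalizing w with
  | _ N ih =>
  by_cases hle : N ≤ Module.finrank ℝ E
  · exact ⟨w, hw, fun _ h => h, rfl, le_rfl, hN ▸ hle⟩
  obtain ⟨w', hw', hsupp, hsum, hc, u₀, hu₀, hu₀'⟩ :=
    exists_smaller_support a l c hw hl (hN ▸ not_le.1 hle)
  have hlt : (Finset.univ.filter fun u => w' u ≠ 0).card < N := by
    rw [← hN]
    refine Finset.card_lt_card (Finset.ssubset_iff_of_subset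
      (Finset.monotone_filter_right _ fun u _ => mt (hsupp u)) |>.2 ⟨u₀, ?_⟩)
    simp [hu₀, hu₀']
  obtain ⟨v, hv, hvs, hva, hvc, hvN⟩ :=
    ih _ hlt hw' (fun u hu => hl u (mt (hsupp u) hu)) rfl
  exact ⟨v, hv, fun u hu => hvs u (hsupp u hu), hva.trans hsum, hvc.trans hc, hvN⟩

end SupportReduction

section Cost

variable {U X Y : Type*} [Fintype U] [Fintype X] [Fintype Y]

lemma condEntropy_nonneg {α β : Type*} [Fintype α] [Fintype β] {p : α × β → ℝ}
    (hp : ∀ w, 0 ≤ p w) : 0 ≤ condEntropy p := by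
  have h := entropy_push_le_of_factors hp (f := id) (g := Prod.fst) fun _ _ => congrArg Prod.fst
  rwa [push_id, ← sub_nonneg] at h

lemma mutualInfo_nonneg {α β : Type*} [Fintype α] [Fintype β] {p : α × β → ℝ}
    (hp : p ∈ stdSimplex ℝ (α × β)) : 0 ≤ mutualInfo p := by
  have h := entropy_push_pair_le hp Prod.fst Prod.snd
  rw [show (fun w : α × β => (w.1, w.2)) = id from rfl, push_id] at h
  exact sub_nonneg.2 h

lemma condEntropy_margUX (p : U × X × Y → ℝ) :
    condEntropy (margUX p) =
      entropy (push (fun w => (w.1, w.2.1)) p) - entropy (push Prod.fst p) := by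
  rw [condEntropy, margUX, push_push, Function.comp_def]

lemma mutualInfo_margUY (p : U × X × Y → ℝ) :
    mutualInfo (margUY p) =
      entropy (push Prod.fst p) + entropy (margY p) - entropy (margUY p) := by
  simp only [mutualInfo, margUY, margY, push_push, Function.comp_def]

lemma margY_eq_push_snd_push_snd (p : U × X × Y → ℝ) :
    margY p = push Prod.snd (push Prod.snd p) := by
  rw [push_push, Function.comp_def, margY]

lemma sum_margUY (p : U × X × Y → ℝ) (y : Y) : ∑ u, margUY p (u, y) = margY p y := by
  rw [← push_snd_apply, margUY, push_push, Function.comp_def, margY]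

/-- The value of `D(p_{UXY} ‖ p_{U|Y} P)` when it is finite, expressed through entropies. In
contrast to `relEntropy p (condTimes p P)` it is visibly continuous in `p`. -/
def condDivergence (P : X × Y → ℝ) (p : U × X × Y → ℝ) : ℝ :=
  entropy (margUY p) - entropy p - entropy (margY p) - ∑ w, p w * Real.logb 2 (P w.2)

/-- The value of `exponentCost P R₂ p` when it is finite. -/
def realCost (P : X × Y → ℝ) (R₂ : ℝ) (p : U × X × Y → ℝ) : ℝ :=
  condDivergence P p + max (mutualInfo (margUY p) - R₂) 0

section CondTimes

variable {P : X × Y → ℝ} {p : U × X × Y → ℝ}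

lemma condTimes_nonneg (hP : ∀ z, 0 ≤ P z) (hp : ∀ w, 0 ≤ p w) (w : U × X × Y) :
    0 ≤ condTimes p P w :=
  mul_nonneg (div_nonneg (push_nonneg _ hp _) (push_nonneg _ hp _)) (hP _)

lemma sum_condTimes_le (hP : ∀ z, 0 ≤ P z) (p : U × X × Y → ℝ) :
    ∑ w, condTimes p P w ≤ ∑ z, P z := by
  rw [Fintype.sum_prod_type, Finset.sum_comm]
  refine Finset.sum_le_sum fun z _ => ?_
  simp only [condTimes, ← Finset.sum_mul, ← Finset.sum_div, sum_margUY]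
  exact mul_le_of_le_one_left (hP z) (div_self_le_one _)

lemma margUY_pos (hp : ∀ w, 0 ≤ p w) {w : U × X × Y} (hw : p w ≠ 0) :
    0 < margUY p (w.1, w.2.2) :=
  push_pos (fun w : U × X × Y => (w.1, w.2.2)) hp hw

lemma margY_pos (hp : ∀ w, 0 ≤ p w) {w : U × X × Y} (hw : p w ≠ 0) : 0 < margY p w.2.2 :=
  push_pos (fun w : U × X × Y => w.2.2) hp hw

lemma absCont_condTimes_iff (hp : ∀ w, 0 ≤ p w) :
    AbsCont p (condTimes p P) ↔ AbsCont p (P ∘ Prod.snd) := by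
  refine ⟨fun h w hw => h w (mul_eq_zero_of_right _ hw), fun h w hw => ?_⟩
  by_contra hne
  exact mul_ne_zero (div_ne_zero (margUY_pos hp hne).ne' (margY_pos hp hne).ne')
    (mt (h w) hne) hw

lemma relEntropy_condTimes (hp : ∀ w, 0 ≤ p w) (hs : AbsCont p (P ∘ Prod.snd)) :
    relEntropy p (condTimes p P) = condDivergence P p := by
  rw [relEntropy_eq_sub_entropy ((absCont_condTimes_iff hp).2 hs), condDivergence, margUY, margY,
    entropy_push_eq_sum, entropy_push_eq_sum, sub_right_comm _ (entropy p),
    sub_right_comm _ (entropy p), ← Finset.sum_sub_distrib, ← Finset.sum_sub_distrib]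
  congr 1
  refine Finset.sum_congr rfl fun w _ => ?_
  by_cases hw : p w = 0
  · simp [hw]
  have hP : P w.2 ≠ 0 := mt (hs w) hw
  have hUY := (margUY_pos hp hw).ne'
  have hY := (margY_pos hp hw).ne'
  rw [condTimes, Real.logb_mul (div_ne_zero hUY hY) hP, Real.logb_div hUY hY, margUY, margY]
  ring

lemma exponentCost_eq_realCost (hp : ∀ w, 0 ≤ p w) (hs : AbsCont p (P ∘ Prod.snd)) (R₂ : ℝ) :
    exponentCost P R₂ p = realCost P R₂ p := by
  rw [exponentCost, klBits_eq_relEntropy ((absCont_condTimes_iff hp).2 hs),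
    relEntropy_condTimes hp hs, realCost, EReal.coe_add]

lemma absCont_of_exponentCost_ne_top (hp : ∀ w, 0 ≤ p w) {R₂ : ℝ}
    (h : exponentCost P R₂ p ≠ ⊤) : AbsCont p (P ∘ Prod.snd) := by
  contrapose! h
  rw [exponentCost, klBits_eq_top (mt (absCont_condTimes_iff hp).1 h), EReal.top_add_coe]

lemma condDivergence_nonneg (hP : P ∈ stdSimplex ℝ (X × Y))
    (hp : p ∈ stdSimplex ℝ (U × X × Y)) (hs : AbsCont p (P ∘ Prod.snd)) :
    0 ≤ condDivergence P p := by
  rw [← relEntropy_condTimes hp.1 hs]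
  refine relEntropy_nonneg hp.1 (condTimes_nonneg hP.1 hp.1) ((absCont_condTimes_iff hp.1).2 hs) ?_
  rw [hp.2, ← hP.2]
  exact sum_condTimes_le hP.1 p

lemma eq_condTimes_of_condDivergence_nonpos (hP : P ∈ stdSimplex ℝ (X × Y))
    (hp : p ∈ stdSimplex ℝ (U × X × Y)) (hs : AbsCont p (P ∘ Prod.snd))
    (h : condDivergence P p ≤ 0) : p = condTimes p P := by
  rw [← relEntropy_condTimes hp.1 hs] at h
  refine eq_of_relEntropy_nonpos hp.1 (condTimes_nonneg hP.1 hp.1)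
    ((absCont_condTimes_iff hp.1).2 hs) ?_ h
  rw [hp.2, ← hP.2]
  exact sum_condTimes_le hP.1 p

lemma exponentCost_nonneg (hP : P ∈ stdSimplex ℝ (X × Y)) (hp : p ∈ stdSimplex ℝ (U × X × Y))
    (R₂ : ℝ) : 0 ≤ exponentCost P R₂ p := by
  by_cases h : exponentCost P R₂ p = ⊤
  · simp [h]
  have hs := absCont_of_exponentCost_ne_top hp.1 h
  rw [exponentCost_eq_realCost hp.1 hs]
  exact_mod_cast add_nonneg (condDivergence_nonneg hP hp hs) (le_max_right _ _)

lemma exponentF_nonneg (hP : P ∈ stdSimplex ℝ (X × Y)) (R₁ R₂ : ℝ) : 0 ≤ exponentF P R₁ R₂ :=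
  le_iInf₂ fun _ _ => le_iInf₂ fun _ hp => le_iInf fun _ => exponentCost_nonneg hP hp R₂

end CondTimes

end Cost

section AlphabetReduction

variable {U X Y : Type*} [Fintype U] [Fintype X] [Fintype Y]

lemma sum_mul_logb_snd (P : X × Y → ℝ) (p : U × X × Y → ℝ) :
    ∑ w, p w * Real.logb 2 (P w.2) = ∑ z, push Prod.snd p z * Real.logb 2 (P z) :=
  (sum_push_mul Prod.snd p fun z => Real.logb 2 (P z)).symm

lemma absCont_comp_snd_iff {P : X × Y → ℝ} {p : U × X × Y → ℝ} (hp : ∀ w, 0 ≤ p w) :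
    AbsCont p (P ∘ Prod.snd) ↔ AbsCont (push Prod.snd p) P :=
  ⟨fun h _ hz => push_eq_zero _ fun a ha => h a ((congrArg P ha).trans hz),
    fun h w hw => le_antisymm ((le_push Prod.snd hp w).trans_eq (h _ hw)) (hp w)⟩

section Mixture

/-- The joint law of `(U, X, Y)` when `U` has law `v` and `(X, Y)` has conditional law `k u` given
`U = u`. -/
def mixture (v : U → ℝ) (k : U → X × Y → ℝ) : U × X × Y → ℝ := fun w => v w.1 * k w.1 w.2

variable {v : U → ℝ} {k : U → X × Y → ℝ}

lemma push_fst_mixture (hk : ∀ u, v u ≠ 0 → ∑ z, k u z = 1) :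
    push Prod.fst (mixture v k) = v := by
  funext u
  simp only [push_fst_apply, mixture, ← Finset.mul_sum]
  by_cases hu : v u = 0
  · rw [hu, zero_mul]
  · rw [hk u hu, mul_one]

lemma push_snd_mixture (v : U → ℝ) (k : U → X × Y → ℝ) :
    push Prod.snd (mixture v k) = ∑ u, v u • k u := by
  funext z
  simp [push_snd_apply, mixture]

lemma entropy_margUY_mixture (hk : ∀ u, v u ≠ 0 → ∑ z, k u z = 1) :
    entropy (margUY (mixture v k)) = entropy v + ∑ u, v u * entropy (push Prod.snd (k u)) :=
  entropy_push_pair_mul hk fun _ => Prod.snd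

lemma entropy_mixture (hk : ∀ u, v u ≠ 0 → ∑ z, k u z = 1) :
    entropy (mixture v k) = entropy v + ∑ u, v u * entropy (k u) := by
  have h := entropy_push_pair_mul hk fun _ => id
  simp only [id, Prod.mk.eta, push_id, ← Function.id_def] at h
  exact h

lemma condEntropy_margUX_mixture (hk : ∀ u, v u ≠ 0 → ∑ z, k u z = 1) :
    condEntropy (margUX (mixture v k)) = ∑ u, v u * entropy (push Prod.fst (k u)) := by
  rw [condEntropy_margUX, push_fst_mixture hk]
  exact sub_eq_of_eq_add' (entropy_push_pair_mul hk fun _ => Prod.fst)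

lemma mutualInfo_margUY_mixture (hk : ∀ u, v u ≠ 0 → ∑ z, k u z = 1) :
    mutualInfo (margUY (mixture v k)) =
      entropy (margY (mixture v k)) - ∑ u, v u * entropy (push Prod.snd (k u)) := by
  rw [mutualInfo_margUY, push_fst_mixture hk, entropy_margUY_mixture hk]
  ring

lemma condDivergence_mixture (P : X × Y → ℝ) (hk : ∀ u, v u ≠ 0 → ∑ z, k u z = 1) :
    condDivergence P (mixture v k) =
      ∑ u, v u * entropy (push Prod.snd (k u)) - ∑ u, v u * entropy (k u)
        - entropy (margY (mixture v k))
        - ∑ z, push Prod.snd (mixture v k) z * Real.logb 2 (P z) := by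
  rw [condDivergence, sum_mul_logb_snd, entropy_margUY_mixture hk, entropy_mixture hk]
  ring

lemma exists_eq_mixture {U : Type*} {p : U × X × Y → ℝ} (hp : ∀ w, 0 ≤ p w) :
    ∃ (v : U → ℝ) (k : U → X × Y → ℝ), (∀ u, 0 ≤ v u) ∧ (∀ u z, 0 ≤ k u z) ∧
      (∀ u, v u ≠ 0 → ∑ z, k u z = 1) ∧ p = mixture v k := by
  have hv : ∀ u, 0 ≤ ∑ z, p (u, z) := fun u => Finset.sum_nonneg fun z _ => hp _
  refine ⟨fun u => ∑ z, p (u, z), fun u z => p (u, z) / ∑ z, p (u, z), hv,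
    fun u z => div_nonneg (hp _) (hv u), fun u hu => ?_, funext fun w => ?_⟩
  · rw [← Finset.sum_div, div_self hu]
  · exact (mul_div_cancel_of_imp' fun h =>
      (Finset.sum_eq_zero_iff_of_nonneg fun z _ => hp (w.1, z)).1 h w.2 (Finset.mem_univ _)).symm

/-- The information quantities of a mixture with weights `v` depend on `v` only through the law of
`(X, Y)` and the averages of three entropies. -/
theorem exists_sparse_mixture (P : X × Y → ℝ) (hv : ∀ u, 0 ≤ v u)
    (hk : ∀ u, v u ≠ 0 → ∑ z, k u z = 1) :
    ∃ v' : U → ℝ, (∀ u, 0 ≤ v' u) ∧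
      (Finset.univ.filter fun u => v' u ≠ 0).card ≤ Fintype.card X * Fintype.card Y + 2 ∧
      condEntropy (margUX (mixture v' k)) ≤ condEntropy (margUX (mixture v k)) ∧
      mutualInfo (margUY (mixture v' k)) = mutualInfo (margUY (mixture v k)) ∧
      condDivergence P (mixture v' k) = condDivergence P (mixture v k) ∧
      push Prod.snd (mixture v' k) = push Prod.snd (mixture v k) := by
  let a : U → (X × Y) ⊕ Fin 2 → ℝ := fun u =>
    Sum.elim (k u) ![entropy (k u), entropy (push Prod.snd (k u))]
  let mass : ((X × Y) ⊕ Fin 2 → ℝ) →ₗ[ℝ] ℝ := ∑ z, LinearMap.proj (Sum.inl z)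
  obtain ⟨v', hv', hzero, ha, hcost, hcard⟩ := exists_weights_card_support_le_finrank a mass
    (fun u => entropy (push Prod.fst (k u))) hv fun u hu => by simpa [a, mass] using hk u hu
  have hk' : ∀ u, v' u ≠ 0 → ∑ z, k u z = 1 := fun u hu => hk u (mt (hzero u) hu)
  have hH : ∑ u, v' u * entropy (k u) = ∑ u, v u * entropy (k u) := by
    simpa [a] using congrFun ha (Sum.inr 0)
  have hHY : ∑ u, v' u * entropy (push Prod.snd (k u)) =
      ∑ u, v u * entropy (push Prod.snd (k u)) := by
    simpa [a] using congrFun ha (Sum.inr 1)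
  have hsnd : push Prod.snd (mixture v' k) = push Prod.snd (mixture v k) := by
    rw [push_snd_mixture, push_snd_mixture]
    funext z
    simpa [a] using congrFun ha (Sum.inl z)
  have hY : margY (mixture v' k) = margY (mixture v k) := by
    rw [margY_eq_push_snd_push_snd, hsnd, ← margY_eq_push_snd_push_snd]
  refine ⟨v', hv', by simpa using hcard, ?_, ?_, ?_, hsnd⟩
  · rwa [condEntropy_margUX_mixture hk', condEntropy_margUX_mixture hk]
  · rw [mutualInfo_margUY_mixture hk', mutualInfo_margUY_mixture hk, hY, hHY]
  · rw [condDivergence_mixture P hk', condDivergence_mixture P hk, hY, hsnd, hH, hHY]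

end Mixture

section Renaming

variable {V : Type*} [Fintype V] {p : U × X × Y → ℝ} {e : U → V}

lemma push_snd_map_fst (e : U → V) (p : U × X × Y → ℝ) :
    push Prod.snd (push (Prod.map e id) p) = push Prod.snd p := by
  rw [push_push, Prod.map_snd', Function.id_comp]

lemma margY_map_fst (e : U → V) (p : U × X × Y → ℝ) : margY (push (Prod.map e id) p) = margY p := by
  rw [margY_eq_push_snd_push_snd, push_snd_map_fst, ← margY_eq_push_snd_push_snd]

lemma entropy_push_map_fst {β : Type*} [Fintype β]
    (he : ∀ a b, p a ≠ 0 → p b ≠ 0 → e a.1 = e b.1 → a.1 = b.1) (f : X × Y → β) :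
    entropy (push (fun w => (w.1, f w.2)) (push (Prod.map e id) p)) =
      entropy (push (fun w => (w.1, f w.2)) p) := by
  rw [push_push]
  refine entropy_push_congr fun a b ha hb => ?_
  have hiff : e a.1 = e b.1 ↔ a.1 = b.1 := ⟨he a b ha hb, congrArg e⟩
  simp [hiff]

lemma entropy_push_fst_map_fst
    (he : ∀ a b, p a ≠ 0 → p b ≠ 0 → e a.1 = e b.1 → a.1 = b.1) :
    entropy (push Prod.fst (push (Prod.map e id) p)) = entropy (push Prod.fst p) := by
  rw [push_push]
  exact entropy_push_congr fun a b ha hb => ⟨he a b ha hb, congrArg e⟩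

lemma condEntropy_margUX_map_fst
    (he : ∀ a b, p a ≠ 0 → p b ≠ 0 → e a.1 = e b.1 → a.1 = b.1) :
    condEntropy (margUX (push (Prod.map e id) p)) = condEntropy (margUX p) := by
  rw [condEntropy_margUX, condEntropy_margUX, entropy_push_map_fst he Prod.fst,
    entropy_push_fst_map_fst he]

lemma mutualInfo_margUY_map_fst
    (he : ∀ a b, p a ≠ 0 → p b ≠ 0 → e a.1 = e b.1 → a.1 = b.1) :
    mutualInfo (margUY (push (Prod.map e id) p)) = mutualInfo (margUY p) := by
  rw [mutualInfo_margUY, mutualInfo_margUY, margUY, margUY, entropy_push_map_fst he Prod.snd,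
    entropy_push_fst_map_fst he, margY_map_fst]

lemma condDivergence_map_fst (P : X × Y → ℝ)
    (he : ∀ a b, p a ≠ 0 → p b ≠ 0 → e a.1 = e b.1 → a.1 = b.1) :
    condDivergence P (push (Prod.map e id) p) = condDivergence P p := by
  have hid : entropy (push (Prod.map e id) p) = entropy p := by
    simpa only [id, Prod.mk.eta, push_id, ← Function.id_def] using entropy_push_map_fst he id
  rw [condDivergence, condDivergence, sum_mul_logb_snd, sum_mul_logb_snd, push_snd_map_fst, hid,
    margY_map_fst, margUY, margUY, entropy_push_map_fst he Prod.snd]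

end Renaming

lemma exists_injOn_of_card_le {α β : Type*} [Fintype β] [Nonempty β] {s : Finset α}
    (h : s.card ≤ Fintype.card β) : ∃ e : α → β, Set.InjOn e s := by
  obtain ⟨e, -, he⟩ := s.finite_toSet.exists_injOn_of_encard_le (t := (Set.univ : Set β))
    (by simpa using h)
  exact ⟨e, he⟩

theorem exists_law_card_auxiliary_le (P : X × Y → ℝ) {p : U × X × Y → ℝ}
    (hp : p ∈ stdSimplex ℝ (U × X × Y)) :
    ∃ p' ∈ stdSimplex ℝ (Fin (Fintype.card X * Fintype.card Y + 2) × X × Y),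
      condEntropy (margUX p') ≤ condEntropy (margUX p) ∧
      mutualInfo (margUY p') = mutualInfo (margUY p) ∧
      condDivergence P p' = condDivergence P p ∧ push Prod.snd p' = push Prod.snd p := by
  obtain ⟨v, k, hv, hk0, hk, rfl⟩ := exists_eq_mixture hp.1
  obtain ⟨v', hv', hcard, hX, hY, hD, hsnd⟩ := exists_sparse_mixture P hv hk
  obtain ⟨e, he⟩ := exists_injOn_of_card_le (hcard.trans_eq (Fintype.card_fin _).symm)
  have hinj : ∀ a b : U × X × Y, mixture v' k a ≠ 0 → mixture v' k b ≠ 0 → e a.1 = e b.1 →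
      a.1 = b.1 := fun a b ha hb hab =>
    he (by simpa using left_ne_zero_of_mul ha) (by simpa using left_ne_zero_of_mul hb) hab
  have hmem : mixture v' k ∈ stdSimplex ℝ (U × X × Y) := by
    refine ⟨fun w => mul_nonneg (hv' _) (hk0 _ _), ?_⟩
    rw [← sum_push Prod.snd, hsnd, sum_push, hp.2]
  exact ⟨_, push_mem_stdSimplex _ hmem, (condEntropy_margUX_map_fst hinj).trans_le hX,
    (mutualInfo_margUY_map_fst hinj).trans hY, (condDivergence_map_fst P hinj).trans hD,
    (push_snd_map_fst e _).trans hsnd⟩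

end AlphabetReduction

section Compactness

variable {U X Y : Type*} [Fintype U] [Fintype X] [Fintype Y]

lemma continuous_condEntropy_margUX :
    Continuous fun p : U × X × Y → ℝ => condEntropy (margUX p) := by
  simp only [condEntropy_margUX]
  exact (continuous_entropy.comp (continuous_push _)).sub
    (continuous_entropy.comp (continuous_push _))

lemma continuous_mutualInfo_margUY :
    Continuous fun p : U × X × Y → ℝ => mutualInfo (margUY p) := by
  simp only [mutualInfo_margUY]
  exact ((continuous_entropy.comp (continuous_push _)).add
    (continuous_entropy.comp (continuous_push _))).sub (continuous_entropy.comp (continuous_push _))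

lemma continuous_condDivergence (P : X × Y → ℝ) :
    Continuous (condDivergence P : (U × X × Y → ℝ) → ℝ) :=
  (((continuous_entropy.comp (continuous_push _)).sub continuous_entropy).sub
    (continuous_entropy.comp (continuous_push _))).sub (by fun_prop)

lemma continuous_realCost (P : X × Y → ℝ) (R₂ : ℝ) :
    Continuous (realCost P R₂ : (U × X × Y → ℝ) → ℝ) :=
  (continuous_condDivergence P).add
    ((continuous_mutualInfo_margUY.sub continuous_const).max continuous_const)

lemma isClosed_setOf_absCont {α : Type*} (q : α → ℝ) : IsClosed {p : α → ℝ | AbsCont p q} := by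
  simp only [AbsCont, Set.ofPred_forall]
  exact isClosed_iInter fun a => isClosed_iInter fun _ =>
    isClosed_eq (continuous_apply a) continuous_const

lemma realCost_antitone (P : X × Y → ℝ) (p : U × X × Y → ℝ) :
    Antitone fun R₂ => realCost P R₂ p := fun _ _ h => by
  dsimp only [realCost]
  gcongr

/-- Laws on `Fin (|X||Y| + 2) × X × Y` that are feasible up to `γ` and have cost at most `γ`. -/
def nearOptimal (P : X × Y → ℝ) (R₁ R₂ γ : ℝ) :
    Set (Fin (Fintype.card X * Fintype.card Y + 2) × X × Y → ℝ) :=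
  {p | p ∈ stdSimplex ℝ (Fin (Fintype.card X * Fintype.card Y + 2) × X × Y) ∧
    AbsCont p (P ∘ Prod.snd) ∧ condEntropy (margUX p) ≤ R₁ + γ ∧ realCost P (R₂ + γ) p ≤ γ}

lemma nearOptimal_mono (P : X × Y → ℝ) (R₁ R₂ : ℝ) : Monotone (nearOptimal P R₁ R₂) :=
  fun γ γ' h _ hp => ⟨hp.1, hp.2.1, hp.2.2.1.trans (by gcongr),
    (realCost_antitone P _ (show R₂ + γ ≤ R₂ + γ' by gcongr)).trans (hp.2.2.2.trans h)⟩

lemma isClosed_nearOptimal (P : X × Y → ℝ) (R₁ R₂ γ : ℝ) : IsClosed (nearOptimal P R₁ R₂ γ) :=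
  (isClosed_stdSimplex _ _).inter <| (isClosed_setOf_absCont _).inter <|
    (isClosed_le continuous_condEntropy_margUX continuous_const).inter <|
      isClosed_le (continuous_realCost P _) continuous_const

lemma isCompact_nearOptimal (P : X × Y → ℝ) (R₁ R₂ γ : ℝ) : IsCompact (nearOptimal P R₁ R₂ γ) :=
  (isCompact_stdSimplex ℝ _).of_isClosed_subset (isClosed_nearOptimal P R₁ R₂ γ) fun _ h => h.1

theorem nearOptimal_zero_nonempty {P : X × Y → ℝ} {R₁ R₂ : ℝ}
    (h : ∀ γ > 0, (nearOptimal P R₁ R₂ γ).Nonempty) : (nearOptimal P R₁ R₂ 0).Nonempty := by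
  obtain ⟨p, hp⟩ := IsCompact.nonempty_iInter_of_sequence_nonempty_isCompact_isClosed
    (fun k : ℕ => nearOptimal P R₁ R₂ (1 / ((k : ℝ) + 1)))
    (fun k => nearOptimal_mono P R₁ R₂ (by push_cast; gcongr; linarith))
    (fun k => h _ (by positivity)) (isCompact_nearOptimal P R₁ R₂ _)
    (fun k => isClosed_nearOptimal P R₁ R₂ _)
  rw [Set.mem_iInter] at hp
  have hγ : Tendsto (fun k : ℕ => 1 / ((k : ℝ) + 1)) atTop (nhds 0) :=
    tendsto_one_div_add_atTop_nhds_zero_nat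
  have hcost : Tendsto (fun k : ℕ => realCost P (R₂ + 1 / ((k : ℝ) + 1)) p) atTop
      (nhds (realCost P (R₂ + 0) p)) :=
    (((hγ.const_add R₂).const_sub _).max tendsto_const_nhds).const_add _
  exact ⟨p, (hp 0).1, (hp 0).2.1, ge_of_tendsto' (hγ.const_add R₁) fun k => (hp k).2.2.1,
    le_of_tendsto_of_tendsto' hcost hγ fun k => (hp k).2.2.2⟩

lemma exponentF_le_realCost {P : X × Y → ℝ} {R₁ R₂ : ℝ}
    {p : Fin (Fintype.card X * Fintype.card Y + 2) × X × Y → ℝ}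
    (hp : p ∈ stdSimplex ℝ (Fin (Fintype.card X * Fintype.card Y + 2) × X × Y))
    (hs : AbsCont p (P ∘ Prod.snd)) (hR : condEntropy (margUX p) ≤ R₁) :
    exponentF P R₁ R₂ ≤ realCost P R₂ p := by
  rw [← exponentCost_eq_realCost hp.1 hs]
  exact iInf₂_le_of_le _ le_rfl <| iInf₂_le_of_le p hp <| iInf_le _ hR

lemma nearOptimal_nonempty_of_law {P : X × Y → ℝ} {R₁ R₂ γ : ℝ} {p : U × X × Y → ℝ}
    (hp : p ∈ stdSimplex ℝ (U × X × Y)) (hs : AbsCont p (P ∘ Prod.snd))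
    (hR : condEntropy (margUX p) ≤ R₁ + γ) (hcost : realCost P (R₂ + γ) p ≤ γ) :
    (nearOptimal P R₁ R₂ γ).Nonempty := by
  obtain ⟨p', hp', hX, hY, hD, hsnd⟩ := exists_law_card_auxiliary_le P hp
  refine ⟨p', hp', ?_, hX.trans hR, by rwa [realCost, hY, hD]⟩
  rwa [absCont_comp_snd_iff hp'.1, hsnd, ← absCont_comp_snd_iff hp.1]

theorem exponentF_nonpos_iff {P : X × Y → ℝ} {R₁ R₂ : ℝ} :
    exponentF P R₁ R₂ ≤ 0 ↔ (nearOptimal P R₁ R₂ 0).Nonempty := by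
  refine ⟨fun h => nearOptimal_zero_nonempty fun γ hγ => ?_, ?_⟩
  · have hlt : exponentF P R₁ R₂ < (γ : EReal) := h.trans_lt (by exact_mod_cast hγ)
    simp only [exponentF, iInf_lt_iff] at hlt
    obtain ⟨m, -, p, hp, hR, hcost⟩ := hlt
    have hs := absCont_of_exponentCost_ne_top hp.1 (hcost.trans (EReal.coe_lt_top _)).ne
    rw [exponentCost_eq_realCost hp.1 hs, EReal.coe_lt_coe_iff] at hcost
    exact nearOptimal_nonempty_of_law hp hs (by linarith)
      ((realCost_antitone P p (by linarith)).trans hcost.le)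
  · rintro ⟨p, hp, hs, hR, hc⟩
    rw [add_zero] at hR hc
    exact (exponentF_le_realCost hp hs hR).trans (by exact_mod_cast hc)

end Compactness

section ChainRule

variable {n : ℕ} {A : Type*}

/-- The first `i` letters of a word, the others being hidden. Prefixes of all lengths thus have the
same type. -/
def mask (i : ℕ) (x : Fin n → A) : Fin n → Option A :=
  fun j => if j.val < i then some (x j) else none

lemma mask_eq_mask_iff {i : ℕ} {x x' : Fin n → A} :
    mask i x = mask i x' ↔ ∀ j : Fin n, j.val < i → x j = x' j := by
  simp only [mask, funext_iff]
  refine forall_congr' fun j => ?_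
  by_cases h : j.val < i <;> simp [h]

lemma mask_succ_eq_iff {i : Fin n} {x x' : Fin n → A} :
    mask (i + 1) x = mask (i + 1) x' ↔ x i = x' i ∧ mask i x = mask i x' := by
  simp only [mask_eq_mask_iff]
  refine ⟨fun h => ⟨h i i.val.lt_succ_self, fun j hj => h j (hj.trans i.val.lt_succ_self)⟩, ?_⟩
  rintro ⟨hi, hlt⟩ j hj
  rcases Nat.lt_succ_iff_lt_or_eq.1 hj with h | h
  · exact hlt j h
  · rw [Fin.ext h, hi]

lemma mask_zero_eq (x x' : Fin n → A) : mask 0 x = mask 0 x' := by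
  simp [mask_eq_mask_iff]

lemma mask_length_eq_iff {x x' : Fin n → A} : mask n x = mask n x' ↔ x = x' := by
  rw [mask_eq_mask_iff, funext_iff]
  exact forall_congr' fun j => forall_prop_of_true j.isLt

variable [Fintype A] {α γ : Type*} [Fintype α] [Fintype γ]

theorem entropy_chain_rule (p : α → ℝ) (x : α → Fin n → A) (h : α → γ) :
    ∑ i : Fin n, (entropy (push (fun a => (x a i, mask i (x a), h a)) p)
        - entropy (push (fun a => (mask i (x a), h a)) p)) =
      entropy (push (fun a => (x a, h a)) p) - entropy (push h p) := by
  have hstep : ∀ i : Fin n, entropy (push (fun a => (x a i, mask i (x a), h a)) p) =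
      entropy (push (fun a => (mask (i + 1) (x a), h a)) p) := fun i =>
    entropy_push_congr fun a b _ _ => by simp only [Prod.mk.injEq, mask_succ_eq_iff, and_assoc]
  have hfull : entropy (push (fun a => (mask n (x a), h a)) p) =
      entropy (push (fun a => (x a, h a)) p) :=
    entropy_push_congr fun a b _ _ => by simp only [Prod.mk.injEq, mask_length_eq_iff]
  have hempty : entropy (push (fun a => (mask 0 (x a), h a)) p) = entropy (push h p) :=
    entropy_push_congr fun a b _ _ => by
      simp only [Prod.mk.injEq, mask_zero_eq (x a) (x b), true_and]
  simp only [hstep]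
  rw [Fin.sum_univ_eq_sum_range (fun i => entropy (push (fun a => (mask (i + 1) (x a), h a)) p)
    - entropy (push (fun a => (mask i (x a), h a)) p)), Finset.sum_range_sub
    (fun i => entropy (push (fun a => (mask i (x a), h a)) p)), hfull, hempty]

lemma entropy_push_le_sum {p : α → ℝ} (hp : p ∈ stdSimplex ℝ α) (x : α → Fin n → A) :
    entropy (push x p) ≤ ∑ i, entropy (push (fun a => x a i) p) := by
  have hchain := entropy_chain_rule p x fun _ => ()
  have hunit : entropy (push (fun a => (x a, ())) p) = entropy (push x p) :=
    entropy_push_congr fun a b _ _ => by simp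
  rw [entropy_push_const hp.2, sub_zero, hunit] at hchain
  rw [← hchain]
  exact Finset.sum_le_sum fun i _ => sub_le_iff_le_add.2 (entropy_push_pair_le hp _ _)

end ChainRule

section SingleLetter

variable {X Y S : Type*} [Fintype X] [Fintype Y] [Fintype S] {n : ℕ}

/-- The side information `g(yⁿ)` together with the first `i` letters of both words. -/
def auxVar (g : (Fin n → Y) → S) (i : ℕ) (w : (Fin n → X) × (Fin n → Y)) :
    (Fin n → Option X) × (Fin n → Option Y) × S :=
  (mask i w.1, mask i w.2, g w.2)

variable {p : (Fin n → X) × (Fin n → Y) → ℝ}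

lemma sum_condEntropy_fst_le (hp : ∀ w, 0 ≤ p w) (g : (Fin n → Y) → S) :
    ∑ i : Fin n, (entropy (push (fun w => (auxVar g i w, w.1 i)) p)
        - entropy (push (auxVar g i) p)) ≤
      entropy (push (fun w => (w.1, g w.2)) p) - entropy (push (fun w => g w.2) p) := by
  rw [← entropy_chain_rule p Prod.fst fun w => g w.2]
  refine Finset.sum_le_sum fun i _ => ?_
  have hsub := entropy_submodular hp (fun w => w.1 i) (fun w => mask i w.2)
    (fun w => (mask i w.1, g w.2))
  have hUX : entropy (push (fun w => (w.1 i, mask i w.2, mask i w.1, g w.2)) p) =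
      entropy (push (fun w => (auxVar g i w, w.1 i)) p) :=
    entropy_push_congr fun a b _ _ => by simp only [auxVar, Prod.mk.injEq]; tauto
  have hU : entropy (push (fun w => (mask i w.2, mask i w.1, g w.2)) p) =
      entropy (push (auxVar g i) p) :=
    entropy_push_congr fun a b _ _ => by simp only [auxVar, Prod.mk.injEq]; tauto
  linarith

lemma entropy_sub_entropy_snd_le (hp : ∀ w, 0 ≤ p w) (g : (Fin n → Y) → S) :
    entropy p - entropy (push Prod.snd p) ≤
      ∑ i : Fin n, (entropy (push (fun w => (auxVar g i w, w.1 i, w.2 i)) p)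
        - entropy (push (fun w => (auxVar g i w, w.2 i)) p)) := by
  have hchain := entropy_chain_rule p Prod.fst Prod.snd
  rw [← Function.id_def, push_id] at hchain
  rw [← hchain]
  refine Finset.sum_le_sum fun i _ => ?_
  have hsub := entropy_submodular hp (fun w => w.1 i) Prod.snd (fun w => (auxVar g i w, w.2 i))
  have hUXY : entropy (push (fun w => (w.1 i, auxVar g i w, w.2 i)) p) =
      entropy (push (fun w => (auxVar g i w, w.1 i, w.2 i)) p) :=
    entropy_push_congr fun a b _ _ => by simp only [Prod.mk.injEq]; tauto
  have hY : ∀ a b : (Fin n → X) × (Fin n → Y),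
      (a.2, auxVar g i a, a.2 i) = (b.2, auxVar g i b, b.2 i) ↔
        mask i a.1 = mask i b.1 ∧ a.2 = b.2 := fun a b => by
    simp only [auxVar, Prod.mk.injEq]
    exact ⟨fun h => ⟨h.2.1.1, h.1⟩, fun h => by simp [h.1, h.2]⟩
  have hXY : entropy (push (fun w => (w.1 i, w.2, auxVar g i w, w.2 i)) p) =
      entropy (push (fun w => (w.1 i, mask i w.1, w.2)) p) :=
    entropy_push_congr fun a b _ _ => by rw [Prod.mk.injEq, hY, Prod.mk.injEq, Prod.mk.injEq]
  have hpast : entropy (push (fun w => (w.2, auxVar g i w, w.2 i)) p) =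
      entropy (push (fun w => (mask i w.1, w.2)) p) :=
    entropy_push_congr fun a b _ _ => by rw [hY, Prod.mk.injEq]
  linarith

lemma sum_condEntropy_pair_eq (p : (Fin n → X) × (Fin n → Y) → ℝ) (g : (Fin n → Y) → S) :
    ∑ i : Fin n, (entropy (push (fun w => (auxVar g i w, w.1 i, w.2 i)) p)
        - entropy (push (auxVar g i) p)) = entropy p - entropy (push (fun w => g w.2) p) := by
  have hchain := entropy_chain_rule p (fun w i => (w.1 i, w.2 i)) fun w => g w.2
  have hmask : ∀ (i : ℕ) (a b : (Fin n → X) × (Fin n → Y)),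
      mask i (fun j => (a.1 j, a.2 j)) = mask i (fun j => (b.1 j, b.2 j)) ↔
        mask i a.1 = mask i b.1 ∧ mask i a.2 = mask i b.2 := fun i a b => by
    simp only [mask_eq_mask_iff, Prod.mk.injEq, ← forall_and]
  have hall : entropy (push (fun w => ((fun i => (w.1 i, w.2 i)), g w.2)) p) = entropy p := by
    refine entropy_push_of_injective (fun a b h => ?_) p
    simp only [Prod.mk.injEq, funext_iff, forall_and] at h
    exact Prod.ext (funext h.1.1) (funext h.1.2)
  rw [hall] at hchain
  rw [← hchain]
  refine Finset.sum_congr rfl fun i _ => congrArg₂ _ ?_ ?_ <;>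
    refine entropy_push_congr fun a b _ _ => ?_ <;>
    simp only [auxVar, Prod.mk.injEq, hmask] <;> tauto

section TimeSharing

/-- The time, the auxiliary variable and the letter pair at that time. -/
def letterAt (g : (Fin n → Y) → S) (v : Fin n × (Fin n → X) × (Fin n → Y)) :
    (Fin n × (Fin n → Option X) × (Fin n → Option Y) × S) × X × Y :=
  ((v.1, auxVar g v.1 v.2), v.2.1 v.1, v.2.2 v.1)

/-- The single-letter law obtained from a law `p` on pairs of words by picking a time at random:
the time and `auxVar` at that time make up the auxiliary variable. -/
def timeSharing (g : (Fin n → Y) → S) (p : (Fin n → X) × (Fin n → Y) → ℝ) :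
    (Fin n × (Fin n → Option X) × (Fin n → Option Y) × S) × X × Y → ℝ :=
  push (letterAt g) fun v => 1 / (n : ℝ) * p v.2

lemma uniform_mul_mem_stdSimplex {Ω : Type*} [Fintype Ω] {q : Ω → ℝ} (hn : n ≠ 0)
    (hq : q ∈ stdSimplex ℝ Ω) :
    (fun v : Fin n × Ω => 1 / (n : ℝ) * q v.2) ∈ stdSimplex ℝ (Fin n × Ω) := by
  refine ⟨fun v => mul_nonneg (by positivity) (hq.1 _), ?_⟩
  simp [Fintype.sum_prod_type, ← Finset.mul_sum, hq.2, hn]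

lemma timeSharing_mem_stdSimplex (hn : n ≠ 0)
    (hp : p ∈ stdSimplex ℝ ((Fin n → X) × (Fin n → Y))) (g : (Fin n → Y) → S) :
    timeSharing g p ∈ stdSimplex ℝ _ :=
  push_mem_stdSimplex _ (uniform_mul_mem_stdSimplex hn hp)

lemma entropy_push_timeSharing {C D : Type*} [Fintype C] [Fintype D] (hp : ∑ w, p w = 1)
    (g : (Fin n → Y) → S)
    (F : (Fin n × (Fin n → Option X) × (Fin n → Option Y) × S) × X × Y → D)
    (f : Fin n → (Fin n → X) × (Fin n → Y) → C)
    (h : ∀ a b, F (letterAt g a) = F (letterAt g b) ↔ a.1 = b.1 ∧ f a.1 a.2 = f b.1 b.2) :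
    entropy (push F (timeSharing g p)) =
      entropy (fun _ : Fin n => 1 / (n : ℝ)) + 1 / n * ∑ i, entropy (push (f i) p) := by
  rw [Finset.mul_sum, ← entropy_push_pair_mul (k := fun _ => p) (fun _ _ => hp) f, timeSharing,
    push_push]
  exact entropy_push_congr fun a b _ _ => by simp [h]

lemma entropy_push_fst_timeSharing (hp : ∑ w, p w = 1) (g : (Fin n → Y) → S) :
    entropy (push Prod.fst (timeSharing g p)) = entropy (fun _ : Fin n => 1 / (n : ℝ)) +
      1 / n * ∑ i : Fin n, entropy (push (auxVar g i) p) :=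
  entropy_push_timeSharing hp g _ (fun i => auxVar g i) (by simp [letterAt])

lemma entropy_margUY_timeSharing (hp : ∑ w, p w = 1) (g : (Fin n → Y) → S) :
    entropy (margUY (timeSharing g p)) = entropy (fun _ : Fin n => 1 / (n : ℝ)) +
      1 / n * ∑ i : Fin n, entropy (push (fun w => (auxVar g i w, w.2 i)) p) :=
  entropy_push_timeSharing hp g _ (fun i w => (auxVar g i w, w.2 i)) (by simp [letterAt, and_assoc])

lemma entropy_timeSharing (hp : ∑ w, p w = 1) (g : (Fin n → Y) → S) :
    entropy (timeSharing g p) = entropy (fun _ : Fin n => 1 / (n : ℝ)) +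
      1 / n * ∑ i : Fin n, entropy (push (fun w => (auxVar g i w, w.1 i, w.2 i)) p) := by
  rw [← push_id (timeSharing g p)]
  exact entropy_push_timeSharing hp g _ (fun i w => (auxVar g i w, w.1 i, w.2 i))
    (by simp [letterAt, and_assoc])

lemma sum_entropy_snd_le_timeSharing (hn : n ≠ 0)
    (hp : p ∈ stdSimplex ℝ ((Fin n → X) × (Fin n → Y))) (g : (Fin n → Y) → S) :
    ∑ i : Fin n, entropy (push (fun w => w.2 i) p) ≤ n * entropy (margY (timeSharing g p)) := by
  have hpair := entropy_push_pair_le (uniform_mul_mem_stdSimplex hn hp) Prod.fst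
    fun v => v.2.2 v.1
  have hfst : push Prod.fst (fun v : Fin n × (Fin n → X) × (Fin n → Y) => 1 / (n : ℝ) * p v.2) =
      fun _ => 1 / (n : ℝ) := by
    funext i
    rw [push_fst_apply, ← Finset.mul_sum, hp.2, mul_one]
  rw [entropy_push_pair_mul (w := fun _ => 1 / (n : ℝ)) (k := fun _ => p) (fun _ _ => hp.2)
    (fun i w => w.2 i), hfst, add_le_add_iff_left, ← Finset.mul_sum, div_mul_eq_mul_div, one_mul,
    div_le_iff₀' (by positivity)] at hpair
  rwa [margY, timeSharing, push_push]

lemma sum_timeSharing_mul_logb {P : X × Y → ℝ} (hs : AbsCont p (iid P n))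
    (g : (Fin n → Y) → S) :
    ∑ w, timeSharing g p w * Real.logb 2 (P w.2) =
      1 / n * ∑ w, p w * Real.logb 2 (iid P n w) := by
  rw [timeSharing, sum_push_mul, Fintype.sum_prod_type, Finset.sum_comm, Finset.mul_sum]
  refine Finset.sum_congr rfl fun w _ => ?_
  by_cases hw : p w = 0
  · simp [hw]
  have hiid : ∏ i, P (w.1 i, w.2 i) ≠ 0 := mt (hs w) hw
  rw [iid, Real.logb_prod (hf := Finset.prod_ne_zero_iff.1 hiid), Finset.mul_sum, Finset.mul_sum]
  exact Finset.sum_congr rfl fun i _ => mul_assoc _ _ _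

lemma absCont_timeSharing {S : Type*} {P : X × Y → ℝ} (hs : AbsCont p (iid P n))
    (g : (Fin n → Y) → S) : AbsCont (timeSharing g p) (P ∘ Prod.snd) := by
  rintro _ hw
  refine push_eq_zero _ ?_
  rintro v rfl
  rw [hs v.2 (Finset.prod_eq_zero (Finset.mem_univ v.1) hw), mul_zero]

lemma mul_condEntropy_timeSharing_le (hp : p ∈ stdSimplex ℝ ((Fin n → X) × (Fin n → Y)))
    (g : (Fin n → Y) → S) :
    n * condEntropy (margUX (timeSharing g p)) ≤
      entropy (push (fun w => (w.1, g w.2)) p) - entropy (push (fun w => g w.2) p) := by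
  refine le_trans (le_of_eq ?_) (sum_condEntropy_fst_le hp.1 g)
  rcases eq_or_ne n 0 with rfl | hn
  · simp
  rw [condEntropy_margUX, entropy_push_fst_timeSharing hp.2, entropy_push_timeSharing hp.2 g
    (fun w => (w.1, w.2.1)) (fun i w => (auxVar g i w, w.1 i)) (by simp [letterAt, and_assoc]),
    Finset.sum_sub_distrib]
  field_simp
  ring

lemma mul_condDivergence_timeSharing_le {P : X × Y → ℝ} (hn : n ≠ 0)
    (hp : p ∈ stdSimplex ℝ ((Fin n → X) × (Fin n → Y))) (hs : AbsCont p (iid P n))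
    (g : (Fin n → Y) → S) :
    n * condDivergence P (timeSharing g p) ≤ relEntropy p (iid P n) := by
  have hX := entropy_sub_entropy_snd_le hp.1 g
  have hY := (entropy_push_le_sum hp Prod.snd).trans (sum_entropy_snd_le_timeSharing hn hp g)
  rw [Finset.sum_sub_distrib] at hX
  rw [relEntropy_eq_neg_entropy_sub hs, condDivergence, entropy_margUY_timeSharing hp.2,
    entropy_timeSharing hp.2, sum_timeSharing_mul_logb hs]
  field_simp
  linarith

lemma mul_condDivergence_add_mutualInfo_timeSharing {P : X × Y → ℝ} (hn : n ≠ 0)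
    (hp : ∑ w, p w = 1) (hs : AbsCont p (iid P n)) (g : (Fin n → Y) → S) :
    n * (condDivergence P (timeSharing g p) + mutualInfo (margUY (timeSharing g p))) =
      entropy (push (fun w => g w.2) p) + relEntropy p (iid P n) := by
  have hXY := sum_condEntropy_pair_eq p g
  rw [Finset.sum_sub_distrib] at hXY
  rw [relEntropy_eq_neg_entropy_sub hs, condDivergence, mutualInfo_margUY,
    entropy_margUY_timeSharing hp, entropy_timeSharing hp, entropy_push_fst_timeSharing hp,
    sum_timeSharing_mul_logb hs]
  field_simp
  linarith

end TimeSharing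

end SingleLetter

section StrongConverse

variable {X Y : Type*} {n : ℕ}

lemma iid_nonneg {P : X × Y → ℝ} (hP : ∀ z, 0 ≤ P z) (n : ℕ) (w : (Fin n → X) × (Fin n → Y)) :
    0 ≤ iid P n w :=
  Finset.prod_nonneg fun _ _ => hP _

variable [Fintype X] [Fintype Y]

lemma sum_iid (P : X × Y → ℝ) (n : ℕ) : ∑ w, iid P n w = (∑ z, P z) ^ n := by
  classical
  have h := Fintype.sum_pow P n
  rw [h, ← (Equiv.arrowProdEquivProdArrow (Fin n) (fun _ => X) (fun _ => Y)).sum_comp]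
  simp [iid]

lemma iid_mem_stdSimplex {P : X × Y → ℝ} (hP : P ∈ stdSimplex ℝ (X × Y)) (n : ℕ) :
    iid P n ∈ stdSimplex ℝ ((Fin n → X) × (Fin n → Y)) :=
  ⟨iid_nonneg hP.1 n, by rw [sum_iid, hP.2, one_pow]⟩

/-- The law is `q` conditioned on `E`. -/
lemma exists_law_relEntropy_eq_neg_logb_prob {Ω : Type*} [Fintype Ω] {q : Ω → ℝ}
    (hq : ∀ a, 0 ≤ q a) {E : Ω → Prop} (hE : 0 < prob q E) :
    ∃ p ∈ stdSimplex ℝ Ω, (∀ a, p a ≠ 0 → E a) ∧ AbsCont p q ∧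
      relEntropy p q = -Real.logb 2 (prob q E) := by
  classical
  have hsum : ∑ a, (if E a then q a else 0) / prob q E = 1 := by
    rw [← Finset.sum_div]
    exact div_self hE.ne'
  refine ⟨fun a => (if E a then q a else 0) / prob q E,
    ⟨fun a => div_nonneg (by split_ifs <;> simp [hq]) hE.le, hsum⟩, fun a ha => ?_,
    fun a ha => by simp [ha], ?_⟩
  · by_contra hEa
    simp [hEa] at ha
  · rw [relEntropy, ← one_mul (-Real.logb 2 (prob q E)), ← hsum, Finset.sum_mul]
    refine Finset.sum_congr rfl fun a _ => ?_
    by_cases hEa : E a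
    · by_cases ha : q a = 0
      · simp [ha]
      · rw [if_pos hEa, div_right_comm, div_self ha, one_div, Real.logb_inv]
    · simp [hEa]

variable {S : Type*} [Fintype S] {P : X × Y → ℝ} {r₁ r₂ : ℝ}

/-- Conditioning the source on correct list decoding and single-letterizing gives a feasible law
whose cost the success probability cannot beat. -/
theorem exists_law_mul_realCost_le (hP : ∀ z, 0 ≤ P z) (hn : n ≠ 0)
    (g : (Fin n → Y) → S) (T : S → Finset (Fin n → X))
    (hT : ∀ s, ((T s).card : ℝ) ≤ (2 : ℝ) ^ (n * r₁))
    (hS : (Fintype.card S : ℝ) ≤ (2 : ℝ) ^ (n * r₂))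
    (hpos : 0 < prob (iid P n) fun w => w.1 ∈ T (g w.2)) :
    ∃ p ∈ stdSimplex ℝ (Fin (Fintype.card X * Fintype.card Y + 2) × X × Y),
      AbsCont p (P ∘ Prod.snd) ∧ condEntropy (margUX p) ≤ r₁ ∧
      n * realCost P r₂ p ≤ -Real.logb 2 (prob (iid P n) fun w => w.1 ∈ T (g w.2)) := by
  obtain ⟨q, hq, hqT, hqP, hD⟩ := exists_law_relEntropy_eq_neg_logb_prob (iid_nonneg hP n) hpos
  have hts := timeSharing_mem_stdSimplex hn hq g
  obtain ⟨p, hp, hX, hY, hdiv, hsnd⟩ := exists_law_card_auxiliary_le P hts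
  have hnpos : (0 : ℝ) < n := by positivity
  have hlist : entropy (push (fun w => (w.1, g w.2)) q) - entropy (push (fun w => g w.2) q) ≤
      n * r₁ := by
    have hswap : entropy (push (fun w => (w.1, g w.2)) q) =
        entropy (push (fun w => (g w.2, w.1)) q) :=
      entropy_push_congr fun a b _ _ => by simp [and_comm]
    rw [hswap]
    exact entropy_push_pair_sub_le hq (fun w => g w.2) Prod.fst hqT hT
  have hmessage := entropy_le_of_card_le (push_mem_stdSimplex (fun w => g w.2) hq) hS
  have hdivergence := mul_condDivergence_timeSharing_le hn hq hqP g
  have hinfo := mul_condDivergence_add_mutualInfo_timeSharing hn hq.2 hqP g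
  refine ⟨p, hp, ?_, ?_, ?_⟩
  · rw [absCont_comp_snd_iff hp.1, hsnd, ← absCont_comp_snd_iff hts.1]
    exact absCont_timeSharing hqP g
  · exact hX.trans (le_of_mul_le_mul_left
      ((mul_condEntropy_timeSharing_le hq g).trans hlist) hnpos)
  · rw [realCost, hY, hdiv, ← hD]
    rcases le_total (mutualInfo (margUY (timeSharing g q)) - r₂) 0 with h | h
    · rwa [max_eq_right h, add_zero]
    · rw [max_eq_left h]
      linarith

lemma twoPowNeg_nonneg (t : EReal) : 0 ≤ twoPowNeg t := by
  rw [twoPowNeg]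
  split_ifs <;> positivity

lemma twoPowNeg_natCast_mul (n : ℕ) (F : ℝ) :
    twoPowNeg ((n : EReal) * (F : EReal)) = (2 : ℝ) ^ (-(n * F)) := by
  rw [← EReal.coe_natCast, ← EReal.coe_mul, twoPowNeg, if_neg (EReal.coe_ne_top _),
    EReal.toReal_coe]

theorem prob_mem_list_le (hP : P ∈ stdSimplex ℝ (X × Y)) (hn : n ≠ 0) (g : (Fin n → Y) → S)
    (T : S → Finset (Fin n → X)) (hT : ∀ s, ((T s).card : ℝ) ≤ (2 : ℝ) ^ (n * r₁))
    (hS : (Fintype.card S : ℝ) ≤ (2 : ℝ) ^ (n * r₂)) :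
    prob (iid P n) (fun w => w.1 ∈ T (g w.2)) ≤ twoPowNeg ((n : EReal) * exponentF P r₁ r₂) := by
  rcases (prob_nonneg (iid_nonneg hP.1 n) fun w => w.1 ∈ T (g w.2)).eq_or_lt with hzero | hpos
  · exact hzero.symm.trans_le (twoPowNeg_nonneg _)
  obtain ⟨p, hp, hs, hR, hcost⟩ := exists_law_mul_realCost_le hP.1 hn g T hT hS hpos
  have hF := exponentF_le_realCost (R₂ := r₂) hp hs hR
  lift exponentF P r₁ r₂ to ℝ using ⟨(hF.trans_lt (EReal.coe_lt_top _)).ne,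
    (EReal.bot_lt_zero.trans_le (exponentF_nonneg hP r₁ r₂)).ne'⟩ with F
  rw [twoPowNeg_natCast_mul, ← Real.logb_le_iff_le_rpow one_lt_two hpos]
  have := mul_le_mul_of_nonneg_left (EReal.coe_le_coe_iff.1 hF) (Nat.cast_nonneg (α := ℝ) n)
  linarith

end StrongConverse

section LeftoverHash

lemma push_add {α β : Type*} [Fintype α] (f : α → β) (p q : α → ℝ) :
    push f (p + q) = push f p + push f q := by
  ext b
  simp only [push, Pi.add_apply, ← Finset.sum_add_distrib]
  exact Finset.sum_congr rfl fun a _ => by split_ifs <;> simp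

variable {A K : Type*} [Fintype A] [Fintype K]

lemma sum_sub_average_sq (x : K → ℝ) :
    ∑ k, (x k - (∑ j, x j) / Fintype.card K) ^ 2 =
      ∑ k, x k ^ 2 - (∑ j, x j) ^ 2 / Fintype.card K := by
  rcases isEmpty_or_nonempty K with _ | _
  · simp
  have hK : (Fintype.card K : ℝ) ≠ 0 := Nat.cast_ne_zero.2 Fintype.card_ne_zero
  simp only [sub_sq, Finset.sum_add_distrib, Finset.sum_sub_distrib, ← Finset.sum_mul,
    ← Finset.mul_sum, Finset.sum_const, Finset.card_univ, nsmul_eq_mul]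
  field_simp
  ring

lemma sum_push_sq (f : A → K) (c : A → ℝ) :
    ∑ k, push f c k ^ 2 =
      ∑ a, ∑ a', c a * c a' * (open Classical in if f a = f a' then 1 else 0) := by
  simp only [sq]
  rw [sum_push_mul f c (push f c)]
  refine Finset.sum_congr rfl fun a _ => ?_
  rw [push, Finset.mul_sum]
  refine Finset.sum_congr rfl fun a' _ => ?_
  by_cases h : f a = f a'
  · simp [h]
  · simp [h, Ne.symm h]

open Classical in
/-- The points that carry more than the fraction `t` of the total mass of `c`. -/
def heavy (c : A → ℝ) (t : ℝ) : Finset A :=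
  Finset.univ.filter fun a => t * ∑ b, c b < c a

lemma card_heavy_le {c : A → ℝ} (hc : ∀ a, 0 ≤ c a) {t : ℝ} (ht : 0 < t) :
    ((heavy c t).card : ℝ) ≤ t⁻¹ := by
  have hle (a : A) : c a ≤ ∑ b, c b :=
    Finset.single_le_sum (fun b _ => hc b) (Finset.mem_univ a)
  rcases (Finset.sum_nonneg fun a _ => hc a : 0 ≤ ∑ b, c b).eq_or_lt with hzero | hpos
  · rw [heavy, Finset.filter_false_of_mem]
    · simp [ht.le]
    · intro a _
      rw [← hzero, mul_zero, not_lt, hzero]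
      exact hle a
  · have hmass : (heavy c t).card * (t * ∑ b, c b) ≤ ∑ b, c b := by
      rw [← nsmul_eq_mul, ← Finset.sum_const]
      exact (Finset.sum_le_sum fun a ha => (Finset.mem_filter.1 ha).2.le).trans
        (Finset.sum_le_sum_of_subset_of_nonneg (Finset.filter_subset _ _) fun a _ _ => hc a)
    rw [← one_div, le_div_iff₀ ht]
    rw [← mul_assoc] at hmass
    exact le_of_mul_le_mul_right (hmass.trans_eq (one_mul _).symm) hpos

variable [DecidableEq A]

/-- The deviation from uniformity, averaged over the hash function with law `Q`, of the image of
the measure `c`. -/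
def hashDev (Q : (A → K) → ℝ) (c : A → ℝ) : ℝ :=
  ∑ f, ∑ k, Q f * |push f c k - (∑ a, c a) / Fintype.card K|

lemma hashDev_add_le {Q : (A → K) → ℝ} (hQ : ∀ f, 0 ≤ Q f) (c d : A → ℝ) :
    hashDev Q (c + d) ≤ hashDev Q c + hashDev Q d := by
  simp only [hashDev, ← Finset.sum_add_distrib, ← mul_add]
  refine Finset.sum_le_sum fun f _ => Finset.sum_le_sum fun k _ =>
    mul_le_mul_of_nonneg_left ?_ (hQ f)
  have hsplit : push f (c + d) k - (∑ a, (c + d) a) / Fintype.card K =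
      (push f c k - (∑ a, c a) / Fintype.card K) +
        (push f d k - (∑ a, d a) / Fintype.card K) := by
    simp only [push_add, Pi.add_apply, Finset.sum_add_distrib]
    ring
  rw [hsplit]
  exact abs_add_le _ _

lemma hashDev_le_two_mul {Q : (A → K) → ℝ} (hQ : Q ∈ stdSimplex ℝ (A → K))
    {c : A → ℝ} (hc : ∀ a, 0 ≤ c a) : hashDev Q c ≤ 2 * ∑ a, c a := by
  rcases isEmpty_or_nonempty K with _ | _
  · simpa [hashDev] using Finset.sum_nonneg fun a _ => hc a
  have hK : (Fintype.card K : ℝ) ≠ 0 := Nat.cast_ne_zero.2 Fintype.card_ne_zero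
  have hmean : 0 ≤ (∑ a, c a) / Fintype.card K :=
    div_nonneg (Finset.sum_nonneg fun a _ => hc a) (Nat.cast_nonneg _)
  have hdev (f : A → K) :
      ∑ k, |push f c k - (∑ a, c a) / Fintype.card K| ≤ 2 * ∑ a, c a :=
    calc ∑ k, |push f c k - (∑ a, c a) / Fintype.card K|
        ≤ ∑ k, (push f c k + (∑ a, c a) / Fintype.card K) :=
          Finset.sum_le_sum fun k _ => by
            have := push_nonneg f hc k
            exact abs_le.2 ⟨by linarith, by linarith⟩
      _ = 2 * ∑ a, c a := by
          rw [Finset.sum_add_distrib, sum_push, Finset.sum_const, Finset.card_univ,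
            nsmul_eq_mul, mul_div_cancel₀ _ hK, two_mul]
  calc hashDev Q c ≤ ∑ f, Q f * (2 * ∑ a, c a) :=
        Finset.sum_le_sum fun f _ => by
          rw [← Finset.mul_sum]
          exact mul_le_mul_of_nonneg_left (hdev f) (hQ.1 f)
    _ = 2 * ∑ a, c a := by rw [← Finset.sum_mul, hQ.2, one_mul]

lemma sum_mul_sum_push_sq (Q : (A → K) → ℝ) (c : A → ℝ) :
    ∑ f, Q f * ∑ k, push f c k ^ 2 =
      ∑ a, ∑ a', c a * c a' * prob Q (fun f => f a = f a') := by
  simp only [sum_push_sq, Finset.mul_sum, prob]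
  rw [Finset.sum_comm]
  refine Finset.sum_congr rfl fun a _ => ?_
  rw [Finset.sum_comm]
  refine Finset.sum_congr rfl fun a' _ => Finset.sum_congr rfl fun f _ => ?_
  by_cases h : f a = f a' <;> simp [h, mul_comm]

lemma IsUniversalHash.prob_collision_le {Q : (A → K) → ℝ} (hu : IsUniversalHash Q)
    (hQ : ∑ f, Q f = 1) (a a' : A) :
    prob Q (fun f => f a = f a') ≤ (if a = a' then 1 else 0) + 1 / (Fintype.card K : ℝ) := by
  split_ifs with h
  · subst h
    simp [prob, hQ]
  · simpa using hu a a' h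

/-- Two distinct points of `A` contribute to the second moment as if they were hashed
independently, so that only the diagonal exceeds the square of the mean. -/
lemma IsUniversalHash.sum_mul_sq_dev_le {Q : (A → K) → ℝ} (hu : IsUniversalHash Q)
    (hQ : ∑ f, Q f = 1) {c : A → ℝ} (hc : ∀ a, 0 ≤ c a) :
    ∑ f, ∑ k, Q f * (push f c k - (∑ a, c a) / Fintype.card K) ^ 2 ≤ ∑ a, c a ^ 2 := by
  have hvariance (f : A → K) : ∑ k, (push f c k - (∑ a, c a) / Fintype.card K) ^ 2 =
      ∑ k, push f c k ^ 2 - (∑ a, c a) ^ 2 / Fintype.card K := by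
    simpa only [sum_push] using sum_sub_average_sq (push f c)
  have hcollisions : ∑ a, ∑ a', c a * c a' * prob Q (fun f => f a = f a') ≤
      ∑ a, c a ^ 2 + (∑ a, c a) ^ 2 / Fintype.card K :=
    calc ∑ a, ∑ a', c a * c a' * prob Q (fun f => f a = f a')
        ≤ ∑ a, ∑ a', c a * c a' * ((if a = a' then 1 else 0) + 1 / (Fintype.card K : ℝ)) :=
          Finset.sum_le_sum fun a _ => Finset.sum_le_sum fun a' _ =>
            mul_le_mul_of_nonneg_left (hu.prob_collision_le hQ a a') (mul_nonneg (hc a) (hc a'))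
      _ = ∑ a, c a ^ 2 + (∑ a, c a) ^ 2 / Fintype.card K := by
          simp only [mul_add, Finset.sum_add_distrib, mul_ite, mul_one, mul_zero,
            Finset.sum_ite_eq, Finset.mem_univ, if_true, ← Finset.sum_mul, ← Finset.mul_sum, sq]
          ring
  calc ∑ f, ∑ k, Q f * (push f c k - (∑ a, c a) / Fintype.card K) ^ 2
      = ∑ f, Q f * ∑ k, push f c k ^ 2 - (∑ a, c a) ^ 2 / Fintype.card K := by
        simp only [← Finset.mul_sum, hvariance, mul_sub, Finset.sum_sub_distrib,
          ← Finset.sum_mul, hQ, one_mul]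
    _ ≤ ∑ a, c a ^ 2 := by
        rw [sum_mul_sum_push_sq]
        exact sub_le_iff_le_add.2 hcollisions

/-- The leftover hash lemma: Cauchy-Schwarz reduces it to the second moment. -/
theorem IsUniversalHash.hashDev_le_sqrt {Q : (A → K) → ℝ} (hu : IsUniversalHash Q)
    (hQ : Q ∈ stdSimplex ℝ (A → K)) {c : A → ℝ} (hc : ∀ a, 0 ≤ c a) :
    hashDev Q c ≤ √(Fintype.card K * ∑ a, c a ^ 2) := by
  refine Real.le_sqrt_of_sq_le ?_
  have hcauchy := Finset.sum_sq_le_sum_mul_sum_of_sq_le_mul (Finset.univ : Finset ((A → K) × K))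
    (r := fun v => Q v.1 * |push v.1 c v.2 - (∑ a, c a) / Fintype.card K|)
    (f := fun v => Q v.1)
    (g := fun v => Q v.1 * (push v.1 c v.2 - (∑ a, c a) / Fintype.card K) ^ 2)
    (fun v _ => hQ.1 _) (fun v _ => mul_nonneg (hQ.1 _) (sq_nonneg _))
    (fun v _ => by rw [mul_pow, sq_abs]; exact le_of_eq (by ring))
  have hmass : ∑ v : (A → K) × K, Q v.1 = Fintype.card K := by
    simp [Fintype.sum_prod_type, ← Finset.mul_sum, hQ.2]
  rw [hmass, Fintype.sum_prod_type, Fintype.sum_prod_type] at hcauchy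
  exact hcauchy.trans
    (mul_le_mul_of_nonneg_left (hu.sum_mul_sq_dev_le hQ.2 hc) (Nat.cast_nonneg _))

/-- The heavy points are charged in full; what remains is flat, so that the leftover hash lemma
is efficient on it. -/
theorem IsUniversalHash.hashDev_le_heavy {Q : (A → K) → ℝ} (hu : IsUniversalHash Q)
    (hQ : Q ∈ stdSimplex ℝ (A → K)) {c : A → ℝ} (hc : ∀ a, 0 ≤ c a) {t : ℝ} (ht : 0 ≤ t) :
    hashDev Q c ≤ 2 * ∑ a ∈ heavy c t, c a + (∑ a, c a) * √(Fintype.card K * t) := by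
  set T := heavy c t with hT
  set C := ∑ a, c a
  have hC0 : 0 ≤ C := Finset.sum_nonneg fun a _ => hc a
  let d : A → ℝ := fun a => if a ∈ T then c a else 0
  let e : A → ℝ := fun a => if a ∈ T then 0 else c a
  have hd : ∀ a, 0 ≤ d a := fun a => by dsimp only [d]; split_ifs <;> simp [hc]
  have he : ∀ a, 0 ≤ e a := fun a => by dsimp only [e]; split_ifs <;> simp [hc]
  have hsplit : c = d + e := funext fun a => by by_cases ha : a ∈ T <;> simp [d, e, ha]
  have hflat : ∑ a, e a ^ 2 ≤ t * C ^ 2 :=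
    calc ∑ a, e a ^ 2 ≤ ∑ a, t * C * c a := by
          refine Finset.sum_le_sum fun a _ => ?_
          by_cases ha : a ∈ T
          · simpa [e, ha] using mul_nonneg (mul_nonneg ht hC0) (hc a)
          · have hlight : c a ≤ t * C := by simpa [hT, heavy] using ha
            simpa [e, ha, sq] using mul_le_mul_of_nonneg_right hlight (hc a)
      _ = t * C ^ 2 := by rw [← Finset.mul_sum]; ring
  have hlight : hashDev Q e ≤ C * √(Fintype.card K * t) :=
    calc hashDev Q e ≤ √(Fintype.card K * ∑ a, e a ^ 2) := hu.hashDev_le_sqrt hQ he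
      _ ≤ √(Fintype.card K * (t * C ^ 2)) := by gcongr
      _ = C * √(Fintype.card K * t) := by
          rw [← mul_assoc, mul_comm, Real.sqrt_mul (sq_nonneg C), Real.sqrt_sq hC0]
  have hheavy : hashDev Q d ≤ 2 * ∑ a ∈ T, c a :=
    (hashDev_le_two_mul hQ hd).trans_eq (by simp [d])
  calc hashDev Q c = hashDev Q (d + e) := by rw [← hsplit]
    _ ≤ hashDev Q d + hashDev Q e := hashDev_add_le hQ.1 d e
    _ ≤ 2 * ∑ a ∈ T, c a + C * √(Fintype.card K * t) := add_le_add hheavy hlight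

end LeftoverHash

section Security

variable {X Y K S : Type*} [Fintype X] [DecidableEq X] [Fintype Y] [Fintype K] {n : ℕ}

lemma keyLaw_apply (P : X × Y → ℝ) (g : (Fin n → Y) → S) (Q : ((Fin n → X) → K) → ℝ)
    (k : K) (s : S) (f : (Fin n → X) → K) :
    keyLaw P g Q (k, s, f) =
      Q f * push f (fun x => push (fun w => (w.1, g w.2)) (iid P n) (x, s)) k := by
  classical
  have hevent : push f (fun x => push (fun w => (w.1, g w.2)) (iid P n) (x, s)) k =
      ∑ w : (Fin n → X) × (Fin n → Y), if f w.1 = k ∧ g w.2 = s then iid P n w else 0 := by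
    rw [Fintype.sum_prod_type, push]
    refine Finset.sum_congr rfl fun x _ => ?_
    rw [push, Fintype.sum_prod_type, Finset.sum_eq_single x (by simp +contextual) (by simp)]
    by_cases h : f x = k <;> simp [h]
  rw [hevent, keyLaw, push, Fintype.sum_prod_type, Finset.mul_sum]
  refine Finset.sum_congr rfl fun w _ => ?_
  rw [Finset.sum_eq_single f (by simp +contextual) (by simp)]
  by_cases h : f w.1 = k ∧ g w.2 = s
  · simp [h.1, h.2, mul_comm]
  · rw [if_neg h, if_neg (by simpa using h), mul_zero]

variable [Fintype S]

lemma securityDelta_eq_sum_hashDev (P : X × Y → ℝ) (g : (Fin n → Y) → S)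
    {Q : ((Fin n → X) → K) → ℝ} (hQ : ∀ f, 0 ≤ Q f) :
    securityDelta P g Q =
      1 / 2 * ∑ s, hashDev Q fun x => push (fun w => (w.1, g w.2)) (iid P n) (x, s) := by
  have hmarginal (s : S) : push (fun w => g w.2) (iid P n) s =
      ∑ x, push (fun w => (w.1, g w.2)) (iid P n) (x, s) := by
    rw [← push_snd_apply, push_push, Function.comp_def]
  rw [securityDelta, dvar]
  congr 1
  simp only [Fintype.sum_prod_type, hashDev]
  rw [Finset.sum_comm]
  refine Finset.sum_congr rfl fun s _ => ?_
  rw [Finset.sum_comm]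
  refine Finset.sum_congr rfl fun f _ => Finset.sum_congr rfl fun k _ => ?_
  rw [keyLaw_apply, idealLaw, ← hmarginal, ← abs_of_nonneg (hQ f), ← abs_mul, abs_of_nonneg (hQ f)]
  congr 1
  ring

lemma sum_sum_push_mem {A B : Type*} [Fintype A] [Fintype B] (g : B → S) (p : A × B → ℝ)
    (T : S → Finset A) :
    ∑ s, ∑ a ∈ T s, push (fun w => (w.1, g w.2)) p (a, s) = prob p fun w => w.1 ∈ T (g w.2) := by
  classical
  rw [← prob_push (fun w => (w.1, g w.2)) p fun v => v.1 ∈ T v.2, prob, Fintype.sum_prod_type,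
    Finset.sum_comm]
  refine Finset.sum_congr rfl fun s _ => ?_
  calc ∑ a ∈ T s, push (fun w => (w.1, g w.2)) p (a, s)
      = ∑ a, if a ∈ T s then push (fun w => (w.1, g w.2)) p (a, s) else 0 := by simp
    _ = _ := Finset.sum_congr rfl fun a _ => by by_cases h : a ∈ T s <;> simp [h]

/-- Given `Sₙ = s`, the heavy sequences form a list for `Xⁿ`, which the leftover hash lemma
leaves out. -/
theorem securityDelta_le_prob_heavy {P : X × Y → ℝ} (hP : P ∈ stdSimplex ℝ (X × Y))
    (g : (Fin n → Y) → S) {Q : ((Fin n → X) → K) → ℝ} (hQ : Q ∈ stdSimplex ℝ ((Fin n → X) → K))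
    (hu : IsUniversalHash Q) {t : ℝ} (ht : 0 ≤ t) :
    securityDelta P g Q ≤
      (prob (iid P n) fun w =>
        w.1 ∈ heavy (fun x => push (fun v => (v.1, g v.2)) (iid P n) (x, g w.2)) t)
      + 1 / 2 * √(Fintype.card K * t) := by
  set J := push (fun w => (w.1, g w.2)) (iid P n) with hJ
  have hJmem : J ∈ stdSimplex ℝ ((Fin n → X) × S) := push_mem_stdSimplex _ (iid_mem_stdSimplex hP n)
  have hmass : ∑ s, ∑ x, J (x, s) = 1 := by
    rw [← hJmem.2, Fintype.sum_prod_type, Finset.sum_comm]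
  calc securityDelta P g Q
      = 1 / 2 * ∑ s, hashDev Q fun x => J (x, s) := securityDelta_eq_sum_hashDev P g hQ.1
    _ ≤ 1 / 2 * ∑ s, (2 * ∑ x ∈ heavy (fun x => J (x, s)) t, J (x, s) +
          (∑ x, J (x, s)) * √(Fintype.card K * t)) := by
        gcongr with s
        exact hu.hashDev_le_heavy hQ (fun x => hJmem.1 (x, s)) ht
    _ = _ := by
        rw [Finset.sum_add_distrib, ← Finset.mul_sum, ← Finset.sum_mul, hmass, one_mul, hJ,
          sum_sum_push_mem g (iid P n) fun s => heavy (fun x => J (x, s)) t]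
        ring

theorem securityDelta_le {P : X × Y → ℝ} (hP : P ∈ stdSimplex ℝ (X × Y)) {R₁ R₂ δ : ℝ}
    (hn : n ≠ 0) (g : (Fin n → Y) → S) {Q : ((Fin n → X) → K) → ℝ}
    (hK : (Fintype.card K : ℝ) ≤ (2 : ℝ) ^ ((n : ℝ) * R₁))
    (hS : (Fintype.card S : ℝ) ≤ (2 : ℝ) ^ ((n : ℝ) * R₂))
    (hQ : Q ∈ stdSimplex ℝ ((Fin n → X) → K)) (hu : IsUniversalHash Q) :
    securityDelta P g Q ≤ twoPowNeg ((n : EReal) * exponentF P (R₁ + δ) R₂)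
      + 1 / 2 * √((2 : ℝ) ^ (-((n : ℝ) * δ))) := by
  set t : ℝ := (2 : ℝ) ^ (-((n : ℝ) * (R₁ + δ))) with ht
  have ht0 : 0 < t := by positivity
  have hlist (s : S) :
      ((heavy (fun x => push (fun w => (w.1, g w.2)) (iid P n) (x, s)) t).card : ℝ) ≤
        (2 : ℝ) ^ ((n : ℝ) * (R₁ + δ)) := by
    refine (card_heavy_le (fun x => push_nonneg _ (iid_nonneg hP.1 n) _) ht0).trans_eq ?_
    rw [ht, ← Real.rpow_neg zero_le_two, neg_neg]
  have hflat : Fintype.card K * t ≤ (2 : ℝ) ^ (-((n : ℝ) * δ)) :=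
    calc Fintype.card K * t ≤ (2 : ℝ) ^ ((n : ℝ) * R₁) * t := by gcongr
      _ = (2 : ℝ) ^ (-((n : ℝ) * δ)) := by
          rw [ht, ← Real.rpow_add two_pos]
          ring_nf
  refine (securityDelta_le_prob_heavy hP g hQ hu ht0.le).trans (add_le_add ?_ (by gcongr))
  exact prob_mem_list_le hP hn g _ hlist hS

end Security

section RandomCoding

variable {α Ω : Type*} [Fintype α] [Fintype Ω]

lemma exists_le_average {q : Ω → ℝ} (hq : q ∈ stdSimplex ℝ Ω) (φ : Ω → ℝ) :
    ∃ ω, φ ω ≤ ∑ ω, q ω * φ ω := by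
  by_contra! hlt
  obtain ⟨ω₀, -, hω₀⟩ : ∃ ω ∈ Finset.univ, q ω ≠ 0 :=
    Finset.exists_ne_zero_of_sum_ne_zero (hq.2.trans_ne one_ne_zero)
  have := Finset.sum_lt_sum
    (fun ω _ => mul_le_mul_of_nonneg_left (hlt ω).le (hq.1 ω))
    ⟨ω₀, Finset.mem_univ _, mul_lt_mul_of_pos_left (hlt ω₀) ((hq.1 ω₀).lt_of_ne' hω₀)⟩
  rw [← Finset.sum_mul, hq.2, one_mul] at this
  exact lt_irrefl _ this

lemma sum_mul_prob_comm (q : Ω → ℝ) (p : α → ℝ) (E : Ω → α → Prop) :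
    ∑ ω, q ω * prob p (E ω) = ∑ a, p a * prob q (fun ω => E ω a) := by
  classical
  simp only [prob, Finset.mul_sum]
  rw [Finset.sum_comm]
  exact Finset.sum_congr rfl fun a _ => Finset.sum_congr rfl fun ω _ => by
    split_ifs <;> simp [mul_comm]

lemma prob_exists_mem_le {ι : Type*} {p : α → ℝ} (hp : ∀ a, 0 ≤ p a) (T : Finset ι)
    (E : ι → α → Prop) : prob p (fun a => ∃ i ∈ T, E i a) ≤ ∑ i ∈ T, prob p (E i) := by
  classical
  induction T using Finset.induction_on with
  | empty => simp [prob]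
  | insert i T hi ih =>
    rw [Finset.sum_insert hi]
    refine le_trans (le_of_eq ?_) ((prob_or_le hp _ _).trans (add_le_add le_rfl ih))
    simp

lemma prod_mem_stdSimplex {ι : Type*} [Fintype ι] [DecidableEq ι] {q : ι → α → ℝ}
    (hq : ∀ i, q i ∈ stdSimplex ℝ α) :
    (fun c : ι → α => ∏ i, q i (c i)) ∈ stdSimplex ℝ (ι → α) :=
  ⟨fun _ => Finset.prod_nonneg fun i _ => (hq i).1 _, by
    rw [← Fintype.prod_sum]
    exact Finset.prod_eq_one fun i _ => (hq i).2⟩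

lemma prob_forall_eq_pow (q : α → ℝ) (M : ℕ) (E : α → Prop) :
    prob (fun c : Fin M → α => ∏ m, q (c m)) (fun c => ∀ m, E (c m)) = prob q E ^ M := by
  classical
  rw [prob, prob, Fintype.sum_pow]
  refine Finset.sum_congr rfl fun c _ => ?_
  rw [Finset.prod_ite_zero]
  simp

end RandomCoding

section Binning

lemma card_collision_mul_le {X K : Type*} [Fintype X] [DecidableEq X] [Fintype K] [DecidableEq K]
    {a b : X} (hab : a ≠ b) :
    (Finset.univ.filter fun h : X → K => h a = h b).card * Fintype.card K ≤
      Fintype.card (X → K) := by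
  have hinj : Function.Injective fun v : {h : X → K // h a = h b} × K =>
      Function.update v.1.1 a v.2 := by
    rintro ⟨⟨h, hh⟩, j⟩ ⟨⟨h', hh'⟩, j'⟩ heq
    have hj : j = j' := by simpa using congrFun heq a
    have hne (x : X) (hx : x ≠ a) : h x = h' x := by
      simpa [Function.update_of_ne hx] using congrFun heq x
    have : h = h' := funext fun x => by
      by_cases hx : x = a
      · rw [hx, hh, hh', hne b hab.symm]
      · exact hne x hx
    simp [this, hj]
  have := Fintype.card_le_of_injective _ hinj
  rwa [Fintype.card_prod, Fintype.card_subtype] at this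

lemma isUniversalHash_uniform (X K : Type*) [Fintype X] [DecidableEq X] [Fintype K] [Nonempty K] :
    IsUniversalHash fun _ : X → K => 1 / (Fintype.card (X → K) : ℝ) := by
  classical
  intro a b hab
  have hK : (0 : ℝ) < Fintype.card K := Nat.cast_pos.2 Fintype.card_pos
  have hXK : (0 : ℝ) < Fintype.card (X → K) := Nat.cast_pos.2 Fintype.card_pos
  have hprob : prob (fun _ : X → K => 1 / (Fintype.card (X → K) : ℝ)) (fun h => h a = h b) =
      (Finset.univ.filter fun h : X → K => h a = h b).card / Fintype.card (X → K) := by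
    rw [prob, ← Finset.sum_filter, Finset.sum_const, nsmul_eq_mul, mul_one_div]
  rw [hprob, div_le_div_iff₀ hXK hK, one_mul]
  exact_mod_cast card_collision_mul_le hab

lemma uniform_mem_stdSimplex (Ω : Type*) [Fintype Ω] [Nonempty Ω] :
    (fun _ : Ω => 1 / (Fintype.card Ω : ℝ)) ∈ stdSimplex ℝ Ω :=
  ⟨fun _ => by positivity, by simp⟩

variable {Ω X K : Type*} [Fintype Ω] [Fintype X] [DecidableEq X] [Fintype K]

theorem IsUniversalHash.exists_prob_collision_le {Q : (X → K) → ℝ} (hu : IsUniversalHash Q)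
    (hQ : Q ∈ stdSimplex ℝ (X → K)) {p : Ω → ℝ} (hp : p ∈ stdSimplex ℝ Ω) (ξ : Ω → X)
    (T : Ω → Finset X) {L : ℝ} (hT : ∀ ω, ((T ω).card : ℝ) ≤ L) :
    ∃ h : X → K, prob p (fun ω => ∃ x ∈ (T ω).erase (ξ ω), h x = h (ξ ω)) ≤
      L / Fintype.card K := by
  have hbin (ω : Ω) : prob Q (fun h => ∃ x ∈ (T ω).erase (ξ ω), h x = h (ξ ω)) ≤
      L / Fintype.card K :=
    calc prob Q (fun h => ∃ x ∈ (T ω).erase (ξ ω), h x = h (ξ ω))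
        ≤ ∑ x ∈ (T ω).erase (ξ ω), prob Q (fun h => h x = h (ξ ω)) :=
          prob_exists_mem_le hQ.1 _ _
      _ ≤ ∑ x ∈ (T ω).erase (ξ ω), 1 / (Fintype.card K : ℝ) :=
          Finset.sum_le_sum fun x hx => hu x (ξ ω) (Finset.ne_of_mem_erase hx)
      _ ≤ L / Fintype.card K := by
          rw [Finset.sum_const, nsmul_eq_mul, mul_one_div]
          gcongr
          exact (Nat.cast_le.2 Finset.card_erase_le).trans (hT ω)
  obtain ⟨h, hh⟩ := exists_le_average hQ
    fun h => prob p (fun ω => ∃ x ∈ (T ω).erase (ξ ω), h x = h (ξ ω))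
  refine ⟨h, hh.trans ?_⟩
  calc ∑ h, Q h * prob p (fun ω => ∃ x ∈ (T ω).erase (ξ ω), h x = h (ξ ω))
      = ∑ ω, p ω * prob Q (fun h => ∃ x ∈ (T ω).erase (ξ ω), h x = h (ξ ω)) :=
        sum_mul_prob_comm Q p fun h ω => ∃ x ∈ (T ω).erase (ξ ω), h x = h (ξ ω)
    _ ≤ ∑ ω, p ω * (L / Fintype.card K) :=
        Finset.sum_le_sum fun ω _ => mul_le_mul_of_nonneg_left (hbin ω) (hp.1 ω)
    _ = L / Fintype.card K := by rw [← Finset.sum_mul, hp.2, one_mul]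

end Binning

section Covering

/-- By convexity of the exponential function. -/
lemma pow_le_one_sub_add_exp {ω B a : ℝ} (hω0 : 0 ≤ ω) (hω1 : ω ≤ 1) (M : ℕ)
    (ha0 : 0 ≤ a) (ha : a ≤ 1 - ω / B) : a ^ M ≤ 1 - ω + Real.exp (-(M / B)) := by
  have hbase : a ≤ Real.exp (-(ω / B)) := by
    rw [sub_eq_neg_add] at ha
    exact ha.trans (Real.add_one_le_exp _)
  have hconvex := convexOn_exp.2 (Set.mem_univ (-(M / B))) (Set.mem_univ 0) hω0
    (sub_nonneg.2 hω1) (by ring)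
  simp only [smul_eq_mul, Real.exp_zero, mul_one] at hconvex
  calc a ^ M ≤ Real.exp (-(ω / B)) ^ M := pow_le_pow_left₀ ha0 hbase M
    _ = Real.exp (ω * -(M / B) + (1 - ω) * 0) := by
        rw [← Real.exp_nat_mul]
        ring_nf
    _ ≤ ω * Real.exp (-(M / B)) + (1 - ω) := hconvex
    _ ≤ Real.exp (-(M / B)) + (1 - ω) := by
        gcongr
        exact mul_le_of_le_one_left (Real.exp_nonneg _) hω1
    _ = 1 - ω + Real.exp (-(M / B)) := add_comm _ _

variable {U Y : Type*} [Fintype U] [Fintype Y]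

/-- If `W` has density at most `B` with respect to `Q` on `A`, then `M ≫ B` independent trials
under `Q` hit `A` about as surely as one trial under `W`. -/
lemma prob_not_pow_le {Q W : U → ℝ} (hQ : Q ∈ stdSimplex ℝ U) (hW : W ∈ stdSimplex ℝ U) {B : ℝ}
    (hB : 0 < B) {A : U → Prop} (hA : ∀ u, A u → W u ≤ B * Q u) (M : ℕ) :
    prob Q (fun u => ¬ A u) ^ M ≤ prob W (fun u => ¬ A u) + Real.exp (-(M / B)) := by
  classical
  have hQA := (prob_add_prob_not Q A).trans hQ.2
  have hWA := (prob_add_prob_not W A).trans hW.2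
  have hdensity : prob W A ≤ B * prob Q A := by
    rw [prob, prob, Finset.mul_sum]
    refine Finset.sum_le_sum fun u _ => ?_
    by_cases h : A u
    · simpa [h] using hA u h
    · simp [h]
  have hmiss := prob_nonneg hW.1 fun u => ¬ A u
  have hbase : prob Q (fun u => ¬ A u) ≤ 1 - prob W A / B := by
    have := (div_le_iff₀' hB).2 hdensity
    linarith
  have := pow_le_one_sub_add_exp (prob_nonneg hW.1 A) (by linarith) M
    (prob_nonneg hQ.1 fun u => ¬ A u) hbase
  linarith

theorem exists_codebook_prob_forall_not_le {Q : U → ℝ} (hQ : Q ∈ stdSimplex ℝ U) {r : Y → ℝ}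
    (hr : r ∈ stdSimplex ℝ Y) {W : Y → U → ℝ} (hW : ∀ y, W y ∈ stdSimplex ℝ U) {B : ℝ}
    (hB : 0 < B) {A : U → Y → Prop} (hA : ∀ u y, A u y → W y u ≤ B * Q u) (M : ℕ) :
    ∃ c : Fin M → U, prob r (fun y => ∀ m, ¬ A (c m) y) ≤
      ∑ y, r y * prob (W y) (fun u => ¬ A u y) + Real.exp (-(M / B)) := by
  classical
  obtain ⟨c, hc⟩ := exists_le_average (prod_mem_stdSimplex fun _ : Fin M => hQ)
    fun c => prob r (fun y => ∀ m, ¬ A (c m) y)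
  refine ⟨c, hc.trans ?_⟩
  calc ∑ c : Fin M → U, (∏ m, Q (c m)) * prob r (fun y => ∀ m, ¬ A (c m) y)
      = ∑ y, r y * prob Q (fun u => ¬ A u y) ^ M := by
        rw [sum_mul_prob_comm]
        simp only [← prob_forall_eq_pow]
    _ ≤ ∑ y, r y * (prob (W y) (fun u => ¬ A u y) + Real.exp (-(M / B))) := by
        gcongr with y
        · exact hr.1 y
        · exact prob_not_pow_le hQ (hW y) hB (fun u => hA u y) M
    _ = _ := by
        simp only [mul_add, Finset.sum_add_distrib]
        rw [← Finset.sum_mul, hr.2, one_mul]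

end Covering

section OneShot

variable {U X Y : Type*} [Fintype U] [Fintype X] [Fintype Y]

/-- The joint law of `(U, X, Y)` when `U` is obtained from `Y` through the channel `W`, so that
`U → Y → X` is a Markov chain. -/
def markovLaw (P : X × Y → ℝ) (W : Y → U → ℝ) : U × X × Y → ℝ :=
  fun w => W w.2.2 w.1 * P w.2

lemma prob_markovLaw (P : X × Y → ℝ) (W : Y → U → ℝ) (E : U → Y → Prop) :
    prob (markovLaw P W) (fun w => E w.1 w.2.2) =
      ∑ y, push Prod.snd P y * prob (W y) (fun u => E u y) := by
  classical
  simp only [prob, markovLaw, Fintype.sum_prod_type, push_snd_apply, Finset.sum_mul_sum]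
  rw [Finset.sum_comm, Finset.sum_congr rfl fun x _ => Finset.sum_comm, Finset.sum_comm]
  refine Finset.sum_congr rfl fun y _ => Finset.sum_congr rfl fun x _ =>
    Finset.sum_congr rfl fun u _ => ?_
  split_ifs <;> simp [mul_comm]

/-- The codeword `u` serves `y`: its likelihood ratio is at most `B`, and given `Y = y` the list
`T u` misses `X` with probability at most `θ`. -/
def Serves (P : X × Y → ℝ) (W : Y → U → ℝ) (Q : U → ℝ) (T : U → Finset X) (B θ : ℝ) (u : U)
    (y : Y) : Prop :=
  W y u ≤ B * Q u ∧ prob (fun x => P (x, y)) (fun x => x ∉ T u) ≤ θ * push Prod.snd P y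

lemma prob_markovLaw_notMem (P : X × Y → ℝ) (W : Y → U → ℝ) (T : U → Finset X) :
    prob (markovLaw P W) (fun w => w.2.1 ∉ T w.1) =
      ∑ y, ∑ u, W y u * prob (fun x => P (x, y)) (fun x => x ∉ T u) := by
  classical
  simp only [prob, markovLaw, Fintype.sum_prod_type, Finset.mul_sum]
  rw [Finset.sum_congr rfl fun u _ => Finset.sum_comm, Finset.sum_comm]
  refine Finset.sum_congr rfl fun y _ => Finset.sum_congr rfl fun u _ =>
    Finset.sum_congr rfl fun x _ => ?_
  split_ifs <;> simp

/-- This is Markov's inequality for the conditional probability of a miss given `(U, Y)`. -/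
lemma prob_markovLaw_lt_le {P : X × Y → ℝ} (hP : ∀ z, 0 ≤ P z) {W : Y → U → ℝ}
    (hW : ∀ y u, 0 ≤ W y u) (T : U → Finset X) {θ : ℝ} (hθ : 0 < θ) :
    prob (markovLaw P W) (fun w => θ * push Prod.snd P w.2.2 <
        prob (fun x => P (x, w.2.2)) (fun x => x ∉ T w.1)) ≤
      θ⁻¹ * prob (markovLaw P W) (fun w => w.2.1 ∉ T w.1) := by
  rw [prob_markovLaw_notMem, prob_markovLaw P W fun u y => θ * push Prod.snd P y <
      prob (fun x => P (x, y)) (fun x => x ∉ T u), Finset.mul_sum]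
  refine Finset.sum_le_sum fun y _ => ?_
  rw [prob, Finset.mul_sum, Finset.mul_sum]
  refine Finset.sum_le_sum fun u _ => ?_
  rw [le_inv_mul_iff₀ hθ]
  split_ifs with h
  · calc θ * (push Prod.snd P y * W y u) = W y u * (θ * push Prod.snd P y) := by ring
      _ ≤ W y u * prob (fun x => P (x, y)) (fun x => x ∉ T u) :=
        mul_le_mul_of_nonneg_left h.le (hW y u)
  · rw [mul_zero, mul_zero]
    exact mul_nonneg (hW y u) (prob_nonneg (fun x => hP (x, y)) _)

lemma exists_codebook_prob_not_serves_le {P : X × Y → ℝ} (hP : P ∈ stdSimplex ℝ (X × Y))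
    {W : Y → U → ℝ} (hW : ∀ y, W y ∈ stdSimplex ℝ U) {Q : U → ℝ} (hQ : Q ∈ stdSimplex ℝ U)
    {B θ : ℝ} (hB : 0 < B) (hθ : 0 < θ) (T : U → Finset X) (M : ℕ) :
    ∃ c : Fin M → U, prob P (fun w => ∀ m, ¬ Serves P W Q T B θ (c m) w.2) ≤
      prob (markovLaw P W) (fun w => B * Q w.1 < W w.2.2 w.1) +
        θ⁻¹ * prob (markovLaw P W) (fun w => w.2.1 ∉ T w.1) + Real.exp (-(M / B)) := by
  have hml (w : U × X × Y) : 0 ≤ markovLaw P W w := mul_nonneg ((hW _).1 _) (hP.1 _)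
  obtain ⟨c, hc⟩ := exists_codebook_prob_forall_not_le hQ (push_mem_stdSimplex Prod.snd hP) hW hB
    (A := Serves P W Q T B θ) (fun u y h => h.1) M
  refine ⟨c, ?_⟩
  rw [prob_push Prod.snd P fun y => ∀ m, ¬ Serves P W Q T B θ (c m) y,
    ← prob_markovLaw P W fun u y => ¬ Serves P W Q T B θ u y] at hc
  refine hc.trans (add_le_add_left ?_ _)
  calc prob (markovLaw P W) (fun w => ¬ Serves P W Q T B θ w.1 w.2.2)
      ≤ prob (markovLaw P W) (fun w => B * Q w.1 < W w.2.2 w.1 ∨ θ * push Prod.snd P w.2.2 <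
          prob (fun x => P (x, w.2.2)) (fun x => x ∉ T w.1)) :=
        prob_mono hml fun w hw => by
          simpa only [Serves, not_and_or, not_le] using hw
    _ ≤ _ := (prob_or_le hml _ _).trans
        (add_le_add_right (prob_markovLaw_lt_le hP.1 (fun y => (hW y).1) T hθ) _)

lemma prob_serves_and_notMem_le {U : Type*} {P : X × Y → ℝ} (hP : P ∈ stdSimplex ℝ (X × Y))
    (W : Y → U → ℝ) (Q : U → ℝ) (T : U → Finset X) (B : ℝ) {θ : ℝ} (hθ : 0 ≤ θ) (c : Y → U) :
    prob P (fun w => Serves P W Q T B θ (c w.2) w.2 ∧ w.1 ∉ T (c w.2)) ≤ θ := by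
  classical
  have hr : push Prod.snd P ∈ stdSimplex ℝ Y := push_mem_stdSimplex _ hP
  rw [prob, Fintype.sum_prod_type, Finset.sum_comm]
  calc _ ≤ ∑ y, θ * push Prod.snd P y := by
        refine Finset.sum_le_sum fun y _ => ?_
        by_cases h : Serves P W Q T B θ (c y) y
        · simpa [h, prob] using h.2
        · simpa [h] using mul_nonneg hθ (hr.1 y)
    _ = θ := by rw [← Finset.mul_sum, hr.2, mul_one]

lemma exists_decoder {X K M : Type*} [Nonempty X] [DecidableEq X] (T : M → Finset X) (e : X → K) :
    ∃ d : K × M → X, ∀ x m, x ∈ T m → d (e x, m) ≠ x → ∃ x' ∈ (T m).erase x, e x' = e x := by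
  have hdec (v : K × M) : ∃ x, (∃ x' ∈ T v.2, e x' = v.1) → x ∈ T v.2 ∧ e x = v.1 := by
    by_cases h : ∃ x' ∈ T v.2, e x' = v.1
    · exact h.imp fun _ hx _ => hx
    · exact ⟨Classical.arbitrary X, fun h' => (h h').elim⟩
  choose d hd using hdec
  refine ⟨d, fun x m hx hne => ?_⟩
  obtain ⟨hmem, heq⟩ := hd (e x, m) ⟨x, hx, rfl⟩
  exact ⟨d (e x, m), Finset.mem_erase.2 ⟨hne, hmem⟩, heq⟩

/-- Random covering of `Y` and random binning of `X`. -/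
theorem exists_oneShot_code [Nonempty X] {P : X × Y → ℝ} (hP : P ∈ stdSimplex ℝ (X × Y))
    {W : Y → U → ℝ} (hW : ∀ y, W y ∈ stdSimplex ℝ U) {Q : U → ℝ} (hQ : Q ∈ stdSimplex ℝ U)
    {B θ L : ℝ} (hB : 0 < B) (hθ : 0 < θ) (T : U → Finset X) (hT : ∀ u, ((T u).card : ℝ) ≤ L)
    (K M : ℕ) [NeZero K] [NeZero M] :
    ∃ (e₁ : X → Fin K) (e₂ : Y → Fin M) (d : Fin K × Fin M → X),
      prob P (fun w => d (e₁ w.1, e₂ w.2) ≠ w.1) ≤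
        prob (markovLaw P W) (fun w => B * Q w.1 < W w.2.2 w.1) +
        θ⁻¹ * prob (markovLaw P W) (fun w => w.2.1 ∉ T w.1) + θ + Real.exp (-(M / B)) + L / K := by
  classical
  obtain ⟨c, hc⟩ := exists_codebook_prob_not_serves_le hP hW hQ hB hθ T M
  have hencoder (y : Y) : ∃ m, (∃ m', Serves P W Q T B θ (c m') y) →
      Serves P W Q T B θ (c m) y := by
    by_cases h : ∃ m', Serves P W Q T B θ (c m') y
    · exact h.imp fun _ hm _ => hm
    · exact ⟨0, fun h' => (h h').elim⟩
  choose e₂ he₂ using hencoder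
  obtain ⟨e₁, he₁⟩ := (isUniversalHash_uniform X (Fin K)).exists_prob_collision_le
    (uniform_mem_stdSimplex _) hP Prod.fst (fun w => T (c (e₂ w.2))) fun w => hT _
  rw [Fintype.card_fin] at he₁
  obtain ⟨d, hd⟩ := exists_decoder (fun m => T (c m)) e₁
  have herror : prob P (fun w => d (e₁ w.1, e₂ w.2) ≠ w.1) ≤
      prob P (fun w => (∀ m, ¬ Serves P W Q T B θ (c m) w.2) ∨
        (Serves P W Q T B θ (c (e₂ w.2)) w.2 ∧ w.1 ∉ T (c (e₂ w.2))) ∨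
        ∃ x ∈ (T (c (e₂ w.2))).erase w.1, e₁ x = e₁ w.1) := by
    refine prob_mono hP.1 fun w hw => ?_
    by_cases hserved : ∃ m, Serves P W Q T B θ (c m) w.2
    · by_cases hmem : w.1 ∈ T (c (e₂ w.2))
      · exact .inr (.inr (hd w.1 (e₂ w.2) hmem hw))
      · exact .inr (.inl ⟨he₂ w.2 hserved, hmem⟩)
    · exact .inl (not_exists.1 hserved)
  have hunion := herror.trans ((prob_or_le hP.1 _ _).trans
    (add_le_add_right (prob_or_le hP.1 _ _) _))
  have hmiss := prob_serves_and_notMem_le hP W Q T B hθ.le fun y => c (e₂ y)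
  refine ⟨e₁, e₂, d, ?_⟩
  linarith

end OneShot

section Chernoff

variable {α : Type*} [Fintype α]

lemma exists_sum_mul_exp_lt_one {p : α → ℝ} (hp : p ∈ stdSimplex ℝ α) {f : α → ℝ}
    (hf : ∑ a, p a * f a < 0) : ∃ t > 0, ∑ a, p a * Real.exp (t * f a) < 1 := by
  have hderiv : HasDerivAt (fun t : ℝ => ∑ a, p a * Real.exp (t * f a)) (∑ a, p a * f a) 0 := by
    refine HasDerivAt.fun_sum fun a _ => ?_
    have hlinear : HasDerivAt (fun t : ℝ => t * f a) (f a) 0 := hasDerivAt_mul_const _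
    simpa using hlinear.exp.const_mul (p a)
  have hone : ∑ a, p a * Real.exp (0 * f a) = 1 := by simpa using hp.2
  have hslope := ((hasDerivAt_iff_tendsto_slope.1 hderiv).eventually (gt_mem_nhds hf)).filter_mono
    (nhdsWithin_mono 0 (s := Set.Ioi 0) fun _ hx => ne_of_gt hx)
  obtain ⟨t, ht, htpos⟩ := (hslope.and self_mem_nhdsWithin).exists
  rw [slope_def_field, hone, sub_zero, div_lt_iff₀ htpos, zero_mul, sub_neg] at ht
  exact ⟨t, htpos, ht⟩

theorem exists_prob_sum_nonneg_le {p : α → ℝ} (hp : p ∈ stdSimplex ℝ α) {f : α → ℝ}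
    (hf : ∑ a, p a * f a < 0) : ∃ ρ : ℝ, 0 ≤ ρ ∧ ρ < 1 ∧ ∀ n : ℕ,
      prob (fun w : Fin n → α => ∏ i, p (w i)) (fun w => 0 ≤ ∑ i, f (w i)) ≤ ρ ^ n := by
  obtain ⟨t, ht, hlt⟩ := exists_sum_mul_exp_lt_one hp hf
  refine ⟨∑ a, p a * Real.exp (t * f a),
    Finset.sum_nonneg fun a _ => mul_nonneg (hp.1 a) (Real.exp_nonneg _), hlt, fun n => ?_⟩
  rw [Fintype.sum_pow, prob]
  refine Finset.sum_le_sum fun w _ => ?_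
  have hprod : 0 ≤ ∏ i, p (w i) := Finset.prod_nonneg fun i _ => hp.1 _
  rw [Finset.prod_mul_distrib, ← Real.exp_sum, ← Finset.mul_sum]
  split_ifs with h
  · exact le_mul_of_one_le_right hprod (Real.one_le_exp (mul_nonneg ht.le h))
  · exact mul_nonneg hprod (Real.exp_nonneg _)

theorem exists_prob_prod_lt_le {p : α → ℝ} (hp : p ∈ stdSimplex ℝ α) {φ : α → ℝ}
    (hφ : ∀ a, p a ≠ 0 → 0 < φ a) {h : ℝ} (hh : ∑ a, p a * -Real.logb 2 (φ a) < h) :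
    ∃ ρ : ℝ, 0 ≤ ρ ∧ ρ < 1 ∧ ∀ n : ℕ, prob (fun w : Fin n → α => ∏ i, p (w i))
      (fun w => ∏ i, φ (w i) < (2 : ℝ) ^ (-((n : ℝ) * h))) ≤ ρ ^ n := by
  have hmean : ∑ a, p a * (-Real.logb 2 (φ a) - h) < 0 := by
    simp only [mul_sub, Finset.sum_sub_distrib]
    rw [← Finset.sum_mul, hp.2]
    linarith
  obtain ⟨ρ, hρ0, hρ1, hρ⟩ := exists_prob_sum_nonneg_le hp hmean
  refine ⟨ρ, hρ0, hρ1, fun n => (prob_mono_of_ne_zero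
    (fun w => Finset.prod_nonneg fun i _ => hp.1 _) fun w hw hlt => ?_).trans (hρ n)⟩
  have hpos (i : Fin n) : 0 < φ (w i) := hφ _ (Finset.prod_ne_zero_iff.1 hw i (Finset.mem_univ i))
  have hlog : ∑ i, Real.logb 2 (φ (w i)) < -(n * h) := by
    rwa [← Real.logb_prod (hf := fun i _ => (hpos i).ne'),
      Real.logb_lt_iff_lt_rpow one_lt_two (Finset.prod_pos fun i _ => hpos i)]
  simp only [Finset.sum_sub_distrib, Finset.sum_neg_distrib, Finset.sum_const, Finset.card_univ,
    Fintype.card_fin, nsmul_eq_mul]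
  linarith

end Chernoff

section TypicalWords

variable {U X Y : Type*} [Fintype U] [Fintype X] [Fintype Y]

/-- The conditional law of `X` given `U`; it is `0` where `U` has probability `0`. -/
def condXU (p : U × X × Y → ℝ) (u : U) (x : X) : ℝ := margUX p (u, x) / push Prod.fst p u

lemma condXU_nonneg {p : U × X × Y → ℝ} (hp : ∀ w, 0 ≤ p w) (u : U) (x : X) : 0 ≤ condXU p u x :=
  div_nonneg (push_nonneg _ hp _) (push_nonneg _ hp _)

lemma sum_condXU_le_one (p : U × X × Y → ℝ) (u : U) : ∑ x, condXU p u x ≤ 1 := by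
  simp only [condXU, ← Finset.sum_div]
  rw [← push_fst_apply, margUX, push_push, Function.comp_def]
  exact div_self_le_one _

lemma margUX_pos {p : U × X × Y → ℝ} (hp : ∀ w, 0 ≤ p w) {w : U × X × Y} (hw : p w ≠ 0) :
    0 < margUX p (w.1, w.2.1) :=
  push_pos (fun w : U × X × Y => (w.1, w.2.1)) hp hw

lemma sum_mul_neg_logb_condXU {p : U × X × Y → ℝ} (hp : ∀ w, 0 ≤ p w) :
    ∑ w, p w * -Real.logb 2 (condXU p w.1 w.2.1) = condEntropy (margUX p) := by
  rw [condEntropy_margUX, entropy_push_eq_sum, entropy_push_eq_sum, ← Finset.sum_sub_distrib]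
  refine Finset.sum_congr rfl fun w _ => ?_
  by_cases hw : p w = 0
  · simp [hw]
  rw [condXU, Real.logb_div (margUX_pos hp hw).ne' (push_pos Prod.fst hp hw).ne', margUX]
  ring

theorem exists_prob_condXU_lt_le {p : U × X × Y → ℝ} (hp : p ∈ stdSimplex ℝ (U × X × Y)) {H : ℝ}
    (hH : condEntropy (margUX p) < H) :
    ∃ ρ : ℝ, 0 ≤ ρ ∧ ρ < 1 ∧ ∀ n : ℕ, prob (fun w : Fin n → U × X × Y => ∏ i, p (w i))
      (fun w => ∏ i, condXU p (w i).1 (w i).2.1 < (2 : ℝ) ^ (-((n : ℝ) * H))) ≤ ρ ^ n :=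
  exists_prob_prod_lt_le hp
    (fun _ hw => div_pos (margUX_pos hp.1 hw) (push_pos Prod.fst hp.1 hw))
    ((sum_mul_neg_logb_condXU hp.1).trans_lt hH)

/-- The words `x` with `p(x | u) ≥ 2 ^ (-nH)`. -/
def likelyWords (p : U × X × Y → ℝ) {n : ℕ} (H : ℝ) (u : Fin n → U) : Finset (Fin n → X) :=
  open Classical in
  Finset.univ.filter fun x => (2 : ℝ) ^ (-((n : ℝ) * H)) ≤ ∏ i, condXU p (u i) (x i)

lemma mem_likelyWords {p : U × X × Y → ℝ} {n : ℕ} {H : ℝ} {u : Fin n → U} {x : Fin n → X} :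
    x ∈ likelyWords p H u ↔ (2 : ℝ) ^ (-((n : ℝ) * H)) ≤ ∏ i, condXU p (u i) (x i) := by
  rw [likelyWords, Finset.mem_filter_univ]

lemma card_likelyWords_le {p : U × X × Y → ℝ} (hp : ∀ w, 0 ≤ p w) {n : ℕ} (H : ℝ)
    (u : Fin n → U) : ((likelyWords p H u).card : ℝ) ≤ (2 : ℝ) ^ ((n : ℝ) * H) := by
  classical
  have hmass : ((likelyWords p H u).card : ℝ) * (2 : ℝ) ^ (-((n : ℝ) * H)) ≤ 1 :=
    calc ((likelyWords p H u).card : ℝ) * (2 : ℝ) ^ (-((n : ℝ) * H))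
        ≤ ∑ x ∈ likelyWords p H u, ∏ i, condXU p (u i) (x i) := by
          rw [← nsmul_eq_mul]
          exact Finset.card_nsmul_le_sum _ _ _ fun x hx => mem_likelyWords.1 hx
      _ ≤ ∑ x : Fin n → X, ∏ i, condXU p (u i) (x i) :=
          Finset.sum_le_univ_sum_of_nonneg fun x =>
            Finset.prod_nonneg fun i _ => condXU_nonneg hp _ _
      _ = ∏ i, ∑ x, condXU p (u i) x := (Fintype.prod_sum _).symm
      _ ≤ 1 := Finset.prod_le_one (fun i _ => Finset.sum_nonneg fun x _ => condXU_nonneg hp _ _)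
          fun i _ => sum_condXU_le_one p _
  rwa [Real.rpow_neg (by norm_num), ← div_eq_mul_inv, div_le_one (by positivity)] at hmass

end TypicalWords

section MarkovChain

variable {U X Y : Type*} [Fintype U] [Fintype X] [Fintype Y]

/-- Both sides have total mass `1`, and `p = p_{U|Y} P` has no mass over `y` if `p_Y(y) = 0`. -/
lemma eq_zero_of_margY_eq_zero {P : X × Y → ℝ} (hP : P ∈ stdSimplex ℝ (X × Y))
    {p : U × X × Y → ℝ} (hp : p ∈ stdSimplex ℝ (U × X × Y)) (h : p = condTimes p P) {z : X × Y}
    (hz : margY p z.2 = 0) : P z = 0 := by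
  have hsnd (z : X × Y) : push Prod.snd p z = margY p z.2 / margY p z.2 * P z := by
    rw [push_snd_apply]
    conv_lhs => rw [h]
    simp only [condTimes, ← Finset.sum_mul, ← Finset.sum_div, sum_margUY]
  have hle (z : X × Y) : push Prod.snd p z ≤ P z := by
    rw [hsnd]
    exact mul_le_of_le_one_left (hP.1 z) (div_self_le_one _)
  have hsum : ∑ z, push Prod.snd p z = ∑ z, P z := by rw [sum_push, hp.2, hP.2]
  rw [Finset.sum_eq_sum_iff_of_le fun z _ => hle z] at hsum
  rw [← hsum z (Finset.mem_univ z), hsnd, hz, div_zero, zero_mul]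

theorem exists_channel_of_eq_condTimes {P : X × Y → ℝ} (hP : P ∈ stdSimplex ℝ (X × Y))
    {p : U × X × Y → ℝ} (hp : p ∈ stdSimplex ℝ (U × X × Y)) (h : p = condTimes p P) :
    ∃ W : Y → U → ℝ, (∀ y, W y ∈ stdSimplex ℝ U) ∧ p = markovLaw P W ∧
      ∀ u y, margY p y ≠ 0 → W y u = margUY p (u, y) / margY p y := by
  classical
  let W : Y → U → ℝ := fun y u =>
    if margY p y = 0 then push Prod.fst p u else margUY p (u, y) / margY p y
  have hW (u : U) (y : Y) (hy : margY p y ≠ 0) : W y u = margUY p (u, y) / margY p y := if_neg hy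
  refine ⟨W, fun y => ?_, funext fun w => ?_, hW⟩
  · by_cases hy : margY p y = 0
    · simpa only [W, if_pos hy] using push_mem_stdSimplex Prod.fst hp
    · refine ⟨fun u => ?_, ?_⟩
      · rw [hW u y hy]
        exact div_nonneg (push_nonneg _ hp.1 _) (push_nonneg _ hp.1 _)
      · simp only [hW _ y hy, ← Finset.sum_div, sum_margUY, div_self hy]
  · conv_lhs => rw [h]
    by_cases hy : margY p w.2.2 = 0
    · rw [markovLaw, condTimes, eq_zero_of_margY_eq_zero hP hp h hy, mul_zero, mul_zero]
    · rw [condTimes, markovLaw, hW _ _ hy]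

lemma channel_pos {p : U × X × Y → ℝ} (hp : ∀ w, 0 ≤ p w) {W : Y → U → ℝ}
    (hW : ∀ u y, margY p y ≠ 0 → W y u = margUY p (u, y) / margY p y) {w : U × X × Y}
    (hw : p w ≠ 0) : 0 < W w.2.2 w.1 := by
  rw [hW _ _ (margY_pos hp hw).ne']
  exact div_pos (margUY_pos hp hw) (margY_pos hp hw)

lemma sum_mul_neg_logb_div_channel {p : U × X × Y → ℝ} (hp : ∀ w, 0 ≤ p w) {W : Y → U → ℝ}
    (hW : ∀ u y, margY p y ≠ 0 → W y u = margUY p (u, y) / margY p y) :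
    ∑ w, p w * -Real.logb 2 (push Prod.fst p w.1 / W w.2.2 w.1) = mutualInfo (margUY p) := by
  rw [mutualInfo_margUY, margUY, margY, entropy_push_eq_sum, entropy_push_eq_sum,
    entropy_push_eq_sum, ← Finset.sum_add_distrib, ← Finset.sum_sub_distrib]
  refine Finset.sum_congr rfl fun w _ => ?_
  by_cases hw : p w = 0
  · simp [hw]
  rw [Real.logb_div (push_pos Prod.fst hp hw).ne' (channel_pos hp hW hw).ne',
    hW _ _ (margY_pos hp hw).ne', Real.logb_div (margUY_pos hp hw).ne' (margY_pos hp hw).ne',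
    margUY, margY]
  ring

theorem exists_prob_lt_channel_le {p : U × X × Y → ℝ} (hp : p ∈ stdSimplex ℝ (U × X × Y))
    {W : Y → U → ℝ} (hW : ∀ u y, margY p y ≠ 0 → W y u = margUY p (u, y) / margY p y)
    {I : ℝ} (hI : mutualInfo (margUY p) < I) :
    ∃ ρ : ℝ, 0 ≤ ρ ∧ ρ < 1 ∧ ∀ n : ℕ, prob (fun w : Fin n → U × X × Y => ∏ i, p (w i))
      (fun w => (2 : ℝ) ^ ((n : ℝ) * I) * ∏ i, push Prod.fst p (w i).1 <
        ∏ i, W (w i).2.2 (w i).1) ≤ ρ ^ n := by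
  obtain ⟨ρ, hρ0, hρ1, hρ⟩ := exists_prob_prod_lt_le hp
    (φ := fun w => push Prod.fst p w.1 / W w.2.2 w.1)
    (fun _ hw => div_pos (push_pos Prod.fst hp.1 hw) (channel_pos hp.1 hW hw))
    ((sum_mul_neg_logb_div_channel hp.1 hW).trans_lt hI)
  refine ⟨ρ, hρ0, hρ1, fun n => (prob_mono_of_ne_zero
    (fun w => Finset.prod_nonneg fun i _ => hp.1 _) fun w hw hlt => ?_).trans (hρ n)⟩
  have hWpos : 0 < ∏ i, W (w i).2.2 (w i).1 := Finset.prod_pos fun i _ =>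
    channel_pos hp.1 hW (Finset.prod_ne_zero_iff.1 hw i (Finset.mem_univ i))
  rwa [Finset.prod_div_distrib, div_lt_iff₀ hWpos, Real.rpow_neg zero_le_two,
    lt_inv_mul_iff₀ (by positivity)]

/-- Words over `U × X × Y` as triples of words. -/
def tripleEquiv (U X Y : Type*) (n : ℕ) :
    (Fin n → U × X × Y) ≃ (Fin n → U) × (Fin n → X) × (Fin n → Y) where
  toFun w := (fun i => (w i).1, fun i => (w i).2.1, fun i => (w i).2.2)
  invFun v := fun i => (v.1 i, v.2.1 i, v.2.2 i)

lemma prob_markovLaw_iid (P : X × Y → ℝ) (W : Y → U → ℝ) (n : ℕ)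
    (E : (Fin n → U) × (Fin n → X) × (Fin n → Y) → Prop) :
    prob (markovLaw (iid P n) fun y u => ∏ i, W (y i) (u i)) E =
      prob (fun w : Fin n → U × X × Y => ∏ i, markovLaw P W (w i))
        (fun w => E (tripleEquiv U X Y n w)) := by
  rw [← prob_comp_equiv (tripleEquiv U X Y n)]
  simp only [markovLaw, iid, tripleEquiv, Equiv.coe_fn_mk, ← Finset.prod_mul_distrib]

end MarkovChain

section DirectPart

lemma natCeil_two_rpow_le {x y : ℝ} (hx : 0 ≤ x) (hxy : x + 1 ≤ y) :
    (⌈(2 : ℝ) ^ x⌉₊ : ℝ) ≤ (2 : ℝ) ^ y := by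
  have hone : 1 ≤ (2 : ℝ) ^ x := Real.one_le_rpow one_le_two hx
  calc (⌈(2 : ℝ) ^ x⌉₊ : ℝ) ≤ 2 * (2 : ℝ) ^ x := Nat.ceil_le_two_mul (by linarith)
    _ = (2 : ℝ) ^ (x + 1) := by rw [Real.rpow_add_one two_ne_zero, mul_comm]
    _ ≤ (2 : ℝ) ^ y := Real.rpow_le_rpow_of_exponent_le one_le_two hxy

lemma two_rpow_div_natCeil_le (x y : ℝ) :
    (2 : ℝ) ^ x / (⌈(2 : ℝ) ^ y⌉₊ : ℝ) ≤ (2 : ℝ) ^ (x - y) := by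
  rw [Real.rpow_sub two_pos]
  gcongr
  exact Nat.le_ceil _

lemma exp_neg_le_inv {t : ℝ} (ht : 0 < t) : Real.exp (-t) ≤ t⁻¹ := by
  rw [Real.exp_neg]
  exact inv_anti₀ ht (by linarith [Real.add_one_le_exp t])

lemma tendsto_two_rpow_neg_natCast_mul {a : ℝ} (ha : 0 < a) :
    Tendsto (fun n : ℕ => (2 : ℝ) ^ (-((n : ℝ) * a))) atTop (nhds 0) :=
  (tendsto_rpow_atBot_of_base_gt_one 2 one_lt_two).comp
    (tendsto_neg_atTop_atBot.comp (tendsto_natCast_atTop_atTop.atTop_mul_const ha))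

lemma nonempty_of_mem_stdSimplex {α : Type*} [Fintype α] {p : α → ℝ} (hp : p ∈ stdSimplex ℝ α) :
    Nonempty α := by
  by_contra h
  rw [not_nonempty_iff] at h
  simpa using hp.2

variable {U X Y : Type*} [Fintype U] [Fintype X] [Fintype Y]

/-- The miss probability of the lists decays like `ρ ^ (2n)`, so that the threshold `θ = ρ ^ n`
of the one-shot code balances its two contributions. -/
theorem exists_code_errorProb_le {P : X × Y → ℝ} (hP : P ∈ stdSimplex ℝ (X × Y))
    {p : U × X × Y → ℝ} (hp : p ∈ stdSimplex ℝ (U × X × Y)) (hm : p = condTimes p P) {H I : ℝ}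
    (hH : condEntropy (margUX p) < H) (hI : mutualInfo (margUY p) < I) :
    ∃ ρ : ℝ, 0 ≤ ρ ∧ ρ < 1 ∧ ∀ (n K M : ℕ) [NeZero K] [NeZero M], ∃ c : Code X Y n,
      c.m₁ = K ∧ c.m₂ = M ∧ c.errorProb P ≤
        3 * ρ ^ n + (2 : ℝ) ^ ((n : ℝ) * I) / M + (2 : ℝ) ^ ((n : ℝ) * H) / K := by
  obtain ⟨⟨x, -⟩⟩ := nonempty_of_mem_stdSimplex hP
  have : Nonempty X := ⟨x⟩
  obtain ⟨W, hW, hpW, hWp⟩ := exists_channel_of_eq_condTimes hP hp hm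
  obtain ⟨α, hα0, hα1, hα⟩ := exists_prob_lt_channel_le hp hWp hI
  obtain ⟨β, hβ0, hβ1, hβ⟩ := exists_prob_condXU_lt_le hp hH
  obtain ⟨ρ, hρ, hρ1⟩ : ∃ ρ, max (max α √β) (1 / 2) ≤ ρ ∧ ρ < 1 := ⟨_, le_rfl,
    max_lt (max_lt hα1 ((Real.sqrt_lt' one_pos).2 (by simpa using hβ1))) one_half_lt_one⟩
  have hρ0 : 0 < ρ := one_half_pos.trans_le ((le_max_right _ _).trans hρ)
  have hαρ : α ≤ ρ := (le_max_left _ _).trans ((le_max_left _ _).trans hρ)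
  have hβρ : β ≤ ρ ^ 2 :=
    (Real.sqrt_le_left hρ0.le).1 ((le_max_right _ _).trans ((le_max_left _ _).trans hρ))
  refine ⟨ρ, hρ0.le, hρ1, fun n K M _ _ => ?_⟩
  obtain ⟨e₁, e₂, d, hd⟩ := exists_oneShot_code (iid_mem_stdSimplex hP n)
    (fun y => prod_mem_stdSimplex fun i => hW (y i))
    (prod_mem_stdSimplex fun _ => push_mem_stdSimplex Prod.fst hp)
    (B := (2 : ℝ) ^ ((n : ℝ) * I)) (θ := ρ ^ n) (by positivity) (by positivity)
    (likelyWords p H) (card_likelyWords_le hp.1 H) K M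
  refine ⟨⟨K, M, e₁, e₂, d⟩, rfl, rfl, hd.trans ?_⟩
  simp only [prob_markovLaw_iid, ← hpW, mem_likelyWords, not_le]
  have hdensity := (hα n).trans (pow_le_pow_left₀ hα0 hαρ n)
  have hmiss : (ρ ^ n)⁻¹ * prob (fun w : Fin n → U × X × Y => ∏ i, p (w i))
      (fun w => ∏ i, condXU p (w i).1 (w i).2.1 < (2 : ℝ) ^ (-((n : ℝ) * H))) ≤ ρ ^ n := by
    rw [inv_mul_le_iff₀ (by positivity), ← mul_pow, ← sq]
    exact (hβ n).trans (pow_le_pow_left₀ hβ0 hβρ n)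
  have hexp : Real.exp (-(M / (2 : ℝ) ^ ((n : ℝ) * I))) ≤ (2 : ℝ) ^ ((n : ℝ) * I) / M := by
    have hM : (0 : ℝ) < M := Nat.cast_pos.2 (NeZero.pos M)
    exact (exp_neg_le_inv (by positivity)).trans_eq (inv_div _ _)
  calc _ ≤ ρ ^ n + ρ ^ n + ρ ^ n + (2 : ℝ) ^ ((n : ℝ) * I) / M + (2 : ℝ) ^ ((n : ℝ) * H) / K :=
        add_le_add_left (add_le_add (add_le_add_left (add_le_add hdensity hmiss) _) hexp) _
    _ = _ := by ring

theorem eventually_exists_code {P : X × Y → ℝ} (hP : P ∈ stdSimplex ℝ (X × Y))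
    {p : U × X × Y → ℝ} (hp : p ∈ stdSimplex ℝ (U × X × Y)) (hm : p = condTimes p P) {R₁ R₂ : ℝ}
    (hR₁ : condEntropy (margUX p) ≤ R₁) (hR₂ : mutualInfo (margUY p) ≤ R₂) {γ : ℝ} (hγ : 0 < γ) :
    ∀ᶠ n : ℕ in atTop, ∃ c : Code X Y n, (c.m₁ : ℝ) ≤ (2 : ℝ) ^ ((n : ℝ) * (R₁ + γ)) ∧
      (c.m₂ : ℝ) ≤ (2 : ℝ) ^ ((n : ℝ) * (R₂ + γ)) ∧ c.errorProb P ≤ γ := by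
  obtain ⟨a, ha, rfl⟩ : ∃ a > 0, γ = 3 * a := ⟨γ / 3, by positivity, by ring⟩
  have hR₁0 : 0 ≤ R₁ := (condEntropy_nonneg (push_nonneg _ hp.1)).trans hR₁
  have hR₂0 : 0 ≤ R₂ := (mutualInfo_nonneg (push_mem_stdSimplex _ hp)).trans hR₂
  obtain ⟨ρ, hρ0, hρ1, hρ⟩ := exists_code_errorProb_le hP hp hm
    (H := R₁ + a) (I := R₂ + a) (by linarith) (by linarith)
  have hlim : Tendsto (fun n : ℕ => 3 * ρ ^ n + (2 : ℝ) ^ (-((n : ℝ) * a)) +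
      (2 : ℝ) ^ (-((n : ℝ) * a))) atTop (nhds 0) := by
    have htwo := tendsto_two_rpow_neg_natCast_mul ha
    simpa using (((tendsto_pow_atTop_nhds_zero_of_lt_one hρ0 hρ1).const_mul 3).add htwo).add htwo
  have hlarge : ∀ᶠ n : ℕ in atTop, 1 ≤ (n : ℝ) * a :=
    (tendsto_natCast_atTop_atTop.atTop_mul_const ha).eventually_ge_atTop 1
  filter_upwards [hlim.eventually (gt_mem_nhds hγ), hlarge] with n herror hna
  have (R : ℝ) : NeZero ⌈(2 : ℝ) ^ ((n : ℝ) * (R + 2 * a))⌉₊ :=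
    ⟨(Nat.ceil_pos.2 (by positivity)).ne'⟩
  obtain ⟨c, hc₁, hc₂, hc⟩ := hρ n ⌈(2 : ℝ) ^ ((n : ℝ) * (R₁ + 2 * a))⌉₊
    ⌈(2 : ℝ) ^ ((n : ℝ) * (R₂ + 2 * a))⌉₊
  have hdecay (R : ℝ) : (2 : ℝ) ^ ((n : ℝ) * (R + a)) /
      (⌈(2 : ℝ) ^ ((n : ℝ) * (R + 2 * a))⌉₊ : ℝ) ≤ (2 : ℝ) ^ (-((n : ℝ) * a)) :=
    (two_rpow_div_natCeil_le _ _).trans_eq (by ring_nf)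
  refine ⟨c, ?_, ?_, hc.trans (le_trans ?_ herror.le)⟩
  · rw [hc₁]
    exact natCeil_two_rpow_le (by positivity) (by linarith)
  · rw [hc₂]
    exact natCeil_two_rpow_le (by positivity) (by linarith)
  · exact add_le_add (add_le_add_right (hdecay R₂) _) (hdecay R₁)

end DirectPart

section Diagonalization

lemma exists_tendsto_zero_of_forall_eventually {p : ℕ → ℝ → Prop}
    (h : ∀ γ > 0, ∀ᶠ n in atTop, p n γ) :
    ∃ γ : ℕ → ℝ, Tendsto γ atTop (nhds 0) ∧ ∀ᶠ n in atTop, p n (γ n) := by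
  have hnear (n : ℕ) : ∃ γ, (∃ γ', 0 ≤ γ' ∧ p n γ') →
      (0 ≤ γ ∧ p n γ) ∧ γ < sInf {γ | 0 ≤ γ ∧ p n γ} + 1 / ((n : ℝ) + 1) := by
    by_cases hne : {γ | 0 ≤ γ ∧ p n γ}.Nonempty
    · obtain ⟨γ, hγ, hlt⟩ :=
        exists_lt_of_csInf_lt hne (lt_add_of_pos_right _ Nat.one_div_pos_of_nat)
      exact ⟨γ, fun _ => ⟨hγ, hlt⟩⟩
    · exact ⟨0, fun hne' => (hne hne').elim⟩
  choose γ hγ using hnear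
  have hmem : ∀ᶠ n in atTop, 0 ≤ γ n ∧ p n (γ n) := by
    filter_upwards [h 1 one_pos] with n hn using (hγ n ⟨1, zero_le_one, hn⟩).1
  refine ⟨γ, tendsto_order.2 ⟨fun b hb => ?_, fun b hb => ?_⟩, hmem.mono fun n hn => hn.2⟩
  · exact hmem.mono fun n hn => hb.trans_le hn.1
  · filter_upwards [h (b / 2) (half_pos hb),
      tendsto_one_div_add_atTop_nhds_zero_nat.eventually (gt_mem_nhds (half_pos hb))] with n hn hlt
    have hinf : sInf {γ | 0 ≤ γ ∧ p n γ} ≤ b / 2 :=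
      csInf_le ⟨0, fun _ hx => hx.1⟩ ⟨(half_pos hb).le, hn⟩
    linarith [(hγ n ⟨b / 2, (half_pos hb).le, hn⟩).2]

lemma one_div_mul_logb_le_iff {n m : ℕ} (hn : n ≠ 0) (hm : m ≠ 0) (R : ℝ) :
    1 / (n : ℝ) * Real.logb 2 m ≤ R ↔ (m : ℝ) ≤ (2 : ℝ) ^ ((n : ℝ) * R) := by
  have hmpos : (0 : ℝ) < m := by positivity
  have hnpos : (0 : ℝ) < n := by positivity
  rw [one_div, inv_mul_le_iff₀ hnpos, Real.logb_le_iff_le_rpow one_lt_two hmpos]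

lemma limsup_rate_le {m : ℕ → ℕ} (hm : ∀ n, m n ≠ 0) {R : ℝ} {γ : ℕ → ℝ}
    (hγ : Tendsto γ atTop (nhds 0))
    (h : ∀ᶠ n in atTop, (m n : ℝ) ≤ (2 : ℝ) ^ ((n : ℝ) * (R + γ n))) :
    limsup (fun n : ℕ => ((1 / (n : ℝ) * Real.logb 2 (m n : ℝ) : ℝ) : EReal)) atTop ≤ R := by
  have hlim : Tendsto (fun n => ((R + γ n : ℝ) : EReal)) atTop (nhds (R : EReal)) :=
    (continuous_coe_real_ereal.tendsto R).comp (by simpa using hγ.const_add R)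
  rw [← hlim.limsup_eq]
  refine limsup_le_limsup ?_
  filter_upwards [h, eventually_ne_atTop 0] with n hmn hn
  exact EReal.coe_le_coe_iff.2 ((one_div_mul_logb_le_iff hn (hm n) _).2 hmn)

lemma eventually_le_two_rpow_of_limsup_rate_le {m : ℕ → ℕ} {R γ : ℝ} (hγ : 0 < γ)
    (h : limsup (fun n : ℕ => ((1 / (n : ℝ) * Real.logb 2 (m n : ℝ) : ℝ) : EReal)) atTop ≤ R) :
    ∀ᶠ n : ℕ in atTop, (m n : ℝ) ≤ (2 : ℝ) ^ ((n : ℝ) * (R + γ)) := by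
  have hR : (R : EReal) < ((R + γ : ℝ) : EReal) := EReal.coe_lt_coe_iff.2 (by linarith)
  filter_upwards [eventually_lt_of_limsup_lt (h.trans_lt hR), eventually_ne_atTop 0] with n hlt hn
  rcases eq_or_ne (m n) 0 with hm | hm
  · rw [hm, Nat.cast_zero]
    positivity
  · exact (one_div_mul_logb_le_iff hn hm _).1 (EReal.coe_lt_coe_iff.1 hlt).le

end Diagonalization

section Achievability

variable {X Y : Type*} [Fintype X] [Fintype Y]

lemma mem_achievableRegion_of_eventually {P : X × Y → ℝ} (hP : P ∈ stdSimplex ℝ (X × Y))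
    {R₁ R₂ : ℝ} (h : ∀ γ > 0, ∀ᶠ n : ℕ in atTop, ∃ c : Code X Y n,
      (c.m₁ : ℝ) ≤ (2 : ℝ) ^ ((n : ℝ) * (R₁ + γ)) ∧
      (c.m₂ : ℝ) ≤ (2 : ℝ) ^ ((n : ℝ) * (R₂ + γ)) ∧ c.errorProb P ≤ γ) :
    (R₁, R₂) ∈ achievableRegion P := by
  obtain ⟨⟨x, y⟩⟩ := nonempty_of_mem_stdSimplex hP
  obtain ⟨γ, hγ, hcode⟩ := exists_tendsto_zero_of_forall_eventually h
  have hchoice (n : ℕ) : ∃ c : Code X Y n, (∃ c : Code X Y n,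
      (c.m₁ : ℝ) ≤ (2 : ℝ) ^ ((n : ℝ) * (R₁ + γ n)) ∧
      (c.m₂ : ℝ) ≤ (2 : ℝ) ^ ((n : ℝ) * (R₂ + γ n)) ∧ c.errorProb P ≤ γ n) →
      (c.m₁ : ℝ) ≤ (2 : ℝ) ^ ((n : ℝ) * (R₁ + γ n)) ∧
      (c.m₂ : ℝ) ≤ (2 : ℝ) ^ ((n : ℝ) * (R₂ + γ n)) ∧ c.errorProb P ≤ γ n := by
    have : Nonempty (Code X Y n) := ⟨⟨1, 1, fun _ => 0, fun _ => 0, fun _ _ => x⟩⟩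
    exact ⟨Classical.epsilon _, Classical.epsilon_spec⟩
  choose c hc using hchoice
  have hgood := hcode.mono hc
  refine ⟨c, limsup_rate_le (fun n => ((c n).enc₁ fun _ => x).pos.ne') hγ
      (hgood.mono fun n hn => hn.1),
    limsup_rate_le (fun n => ((c n).enc₂ fun _ => y).pos.ne') hγ (hgood.mono fun n hn => hn.2.1),
    squeeze_zero' (.of_forall fun n => prob_nonneg (iid_nonneg hP.1 n) _)
      (hgood.mono fun n hn => hn.2.2) hγ⟩

theorem mem_achievableRegion_of_exponentF_nonpos {P : X × Y → ℝ} (hP : P ∈ stdSimplex ℝ (X × Y))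
    {R₁ R₂ : ℝ} (hF : exponentF P R₁ R₂ ≤ 0) : (R₁, R₂) ∈ achievableRegion P := by
  obtain ⟨p, hp, hs, hR₁, hcost⟩ := exponentF_nonpos_iff.1 hF
  rw [add_zero] at hR₁ hcost
  rw [realCost] at hcost
  have hD := condDivergence_nonneg hP hp hs
  have hmarkov := eq_condTimes_of_condDivergence_nonpos hP hp hs
    (by linarith [le_max_right (mutualInfo (margUY p) - R₂) 0])
  have hR₂ : mutualInfo (margUY p) ≤ R₂ := by
    linarith [le_max_left (mutualInfo (margUY p) - R₂) 0]
  exact mem_achievableRegion_of_eventually hP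
    fun γ hγ => eventually_exists_code hP hp hmarkov hR₁ hR₂ hγ

end Achievability

section Converse

variable {X Y : Type*} [Fintype X] [Fintype Y]

lemma one_sub_errorProb_le {P : X × Y → ℝ} (hP : P ∈ stdSimplex ℝ (X × Y)) {n : ℕ}
    (c : Code X Y n) {T : Fin c.m₂ → Finset (Fin n → X)} (hT : ∀ k s, c.dec (k, s) ∈ T s) :
    1 - c.errorProb P ≤ prob (iid P n) fun w => w.1 ∈ T (c.enc₂ w.2) := by
  have hiid := iid_mem_stdSimplex hP n
  have htotal := prob_add_prob_not (iid P n) fun w => c.dec (c.enc₁ w.1, c.enc₂ w.2) ≠ w.1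
  have hcorrect : prob (iid P n) (fun w => ¬ c.dec (c.enc₁ w.1, c.enc₂ w.2) ≠ w.1) ≤
      prob (iid P n) fun w => w.1 ∈ T (c.enc₂ w.2) :=
    prob_mono hiid.1 fun w hw => not_not.1 hw ▸ hT _ _
  rw [hiid.2] at htotal
  rw [Code.errorProb]
  linarith

theorem nearOptimal_nonempty_of_code {P : X × Y → ℝ} (hP : P ∈ stdSimplex ℝ (X × Y)) {n : ℕ}
    (hn : n ≠ 0) (c : Code X Y n) {R₁ R₂ γ : ℝ}
    (h₁ : (c.m₁ : ℝ) ≤ (2 : ℝ) ^ ((n : ℝ) * (R₁ + γ)))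
    (h₂ : (c.m₂ : ℝ) ≤ (2 : ℝ) ^ ((n : ℝ) * (R₂ + γ))) (he : c.errorProb P ≤ 1 / 2)
    (hγ : 1 ≤ (n : ℝ) * γ) : (nearOptimal P R₁ R₂ γ).Nonempty := by
  classical
  let T : Fin c.m₂ → Finset (Fin n → X) := fun s => Finset.univ.image fun k => c.dec (k, s)
  have hT (s) : ((T s).card : ℝ) ≤ (2 : ℝ) ^ ((n : ℝ) * (R₁ + γ)) := by
    refine le_trans ?_ h₁
    exact_mod_cast Finset.card_image_le.trans_eq (Finset.card_fin _)
  have hhalf : 1 / 2 ≤ prob (iid P n) fun w => w.1 ∈ T (c.enc₂ w.2) := by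
    have := one_sub_errorProb_le hP c (T := T)
      fun k s => Finset.mem_image_of_mem _ (Finset.mem_univ k)
    linarith
  obtain ⟨p, hp, hs, hR, hcost⟩ := exists_law_mul_realCost_le hP.1 hn c.enc₂ T hT
    (by rwa [Fintype.card_fin]) (one_half_pos.trans_le hhalf)
  have hlog : -Real.logb 2 (prob (iid P n) fun w => w.1 ∈ T (c.enc₂ w.2)) ≤ 1 := by
    have := Real.logb_le_logb_of_le one_lt_two one_half_pos hhalf
    rw [one_div, Real.logb_inv, Real.logb_self_eq_one one_lt_two] at this
    linarith
  have hnpos : (0 : ℝ) < n := by positivity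
  exact ⟨p, hp, hs, hR, le_of_mul_le_mul_left ((hcost.trans hlog).trans hγ) hnpos⟩

theorem exponentF_nonpos_of_mem_achievableRegion {P : X × Y → ℝ}
    (hP : P ∈ stdSimplex ℝ (X × Y)) {R₁ R₂ : ℝ} (h : (R₁, R₂) ∈ achievableRegion P) :
    exponentF P R₁ R₂ ≤ 0 := by
  obtain ⟨c, hc₁, hc₂, herr⟩ := h
  refine exponentF_nonpos_iff.2 (nearOptimal_zero_nonempty fun γ hγ => ?_)
  have hlarge : ∀ᶠ n : ℕ in atTop, 1 ≤ (n : ℝ) * γ :=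
    (tendsto_natCast_atTop_atTop.atTop_mul_const hγ).eventually_ge_atTop 1
  obtain ⟨n, h₁, h₂, he, hγn, hn⟩ :=
    ((eventually_le_two_rpow_of_limsup_rate_le hγ hc₁).and
      ((eventually_le_two_rpow_of_limsup_rate_le hγ hc₂).and
        ((herr.eventually (gt_mem_nhds one_half_pos)).and
          (hlarge.and (eventually_ne_atTop 0))))).exists
  exact nearOptimal_nonempty_of_code hP hn (c n) h₁ h₂ he.le hγn

theorem exponentF_pos_iff {P : X × Y → ℝ} (hP : P ∈ stdSimplex ℝ (X × Y)) (R₁ R₂ : ℝ) :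
    0 < exponentF P R₁ R₂ ↔ (R₁, R₂) ∉ achievableRegion P := by
  rw [← not_le, not_iff_not]
  exact ⟨mem_achievableRegion_of_exponentF_nonpos hP, exponentF_nonpos_of_mem_achievableRegion hP⟩

end Converse

section ExponentialDecay

lemma exists_twoPowNeg_natCast_mul_le {F : EReal} (hF : 0 < F) :
    ∃ c > (0 : ℝ), ∀ n : ℕ, n ≠ 0 →
      twoPowNeg ((n : EReal) * F) ≤ (2 : ℝ) ^ (-(c * (n : ℝ))) := by
  induction F with
  | bot => exact absurd hF not_lt_bot
  | top =>
    refine ⟨1, one_pos, fun n hn => ?_⟩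
    rw [EReal.mul_top_of_pos (by exact_mod_cast hn.bot_lt), twoPowNeg, if_pos rfl]
    positivity
  | coe r => exact ⟨r, by exact_mod_cast hF, fun n _ => by rw [twoPowNeg_natCast_mul, mul_comm]⟩

theorem exists_twoPowNeg_add_sqrt_le {F : EReal} (hF : 0 < F) {δ : ℝ} (hδ : 0 < δ) :
    ∃ c > (0 : ℝ), ∃ C > (0 : ℝ), ∀ n : ℕ, n ≠ 0 →
      twoPowNeg ((n : EReal) * F) + 1 / 2 * √((2 : ℝ) ^ (-((n : ℝ) * δ))) ≤
        C * (2 : ℝ) ^ (-(c * (n : ℝ))) := by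
  obtain ⟨b, hb, hF⟩ := exists_twoPowNeg_natCast_mul_le hF
  refine ⟨min b (δ / 2), by positivity, 3 / 2, by norm_num, fun n hn => ?_⟩
  have hexponent : (2 : ℝ) ^ (-(b * (n : ℝ))) ≤ (2 : ℝ) ^ (-(min b (δ / 2) * (n : ℝ))) := by
    gcongr
    · exact one_le_two
    · exact min_le_left _ _
  have hsqrt : √((2 : ℝ) ^ (-((n : ℝ) * δ))) ≤ (2 : ℝ) ^ (-(min b (δ / 2) * (n : ℝ))) :=
    calc √((2 : ℝ) ^ (-((n : ℝ) * δ))) = (2 : ℝ) ^ (-(δ / 2 * (n : ℝ))) := by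
          rw [Real.sqrt_eq_rpow, ← Real.rpow_mul zero_le_two]
          ring_nf
      _ ≤ (2 : ℝ) ^ (-(min b (δ / 2) * (n : ℝ))) := by
          gcongr
          · exact one_le_two
          · exact min_le_right _ _
  linarith [hF n hn]

end ExponentialDecay

end

end WAK

theorem mainTheorem4 {X Y : Type*} [Fintype X] [DecidableEq X] [Fintype Y]
    (P : X × Y → ℝ) (hP : P ∈ stdSimplex ℝ (X × Y)) (R₁ R₂ δ : ℝ) (hδ : 0 < δ) :
    (∀ (n : ℕ), 1 ≤ n → ∀ (K S : Type*) [Fintype K] [Fintype S]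
      (g : (Fin n → Y) → S) (Q : ((Fin n → X) → K) → ℝ),
      (Fintype.card K : ℝ) ≤ (2 : ℝ) ^ ((n : ℝ) * R₁) →
      (Fintype.card S : ℝ) ≤ (2 : ℝ) ^ ((n : ℝ) * R₂) →
      Q ∈ stdSimplex ℝ ((Fin n → X) → K) → WAK.IsUniversalHash Q →
      WAK.securityDelta P g Q ≤
        WAK.twoPowNeg ((n : EReal) * WAK.exponentF P (R₁ + δ) R₂)
          + 1 / 2 * √((2 : ℝ) ^ (-((n : ℝ) * δ)))) ∧
    (0 < WAK.exponentF P (R₁ + δ) R₂ ↔ (R₁ + δ, R₂) ∉ WAK.achievableRegion P) ∧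
    ((R₁ + δ, R₂) ∉ WAK.achievableRegion P →
      ∃ c > (0 : ℝ), ∃ C > (0 : ℝ), ∀ (n : ℕ), 1 ≤ n →
        ∀ (K S : Type*) [Fintype K] [Fintype S]
          (g : (Fin n → Y) → S) (Q : ((Fin n → X) → K) → ℝ),
          (Fintype.card K : ℝ) ≤ (2 : ℝ) ^ ((n : ℝ) * R₁) →
          (Fintype.card S : ℝ) ≤ (2 : ℝ) ^ ((n : ℝ) * R₂) →
          Q ∈ stdSimplex ℝ ((Fin n → X) → K) → WAK.IsUniversalHash Q →
          WAK.securityDelta P g Q ≤ C * (2 : ℝ) ^ (-(c * (n : ℝ)))) := by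
  refine ⟨fun n hn K S _ _ g Q hK hS hQ hu =>
      WAK.securityDelta_le hP (Nat.one_le_iff_ne_zero.1 hn) g hK hS hQ hu,
    WAK.exponentF_pos_iff hP _ _, fun h => ?_⟩
  obtain ⟨c, hc, C, hC, hbound⟩ :=
    WAK.exists_twoPowNeg_add_sqrt_le ((WAK.exponentF_pos_iff hP _ _).2 h) hδ
  refine ⟨c, hc, C, hC, fun n hn K S _ _ g Q hK hS hQ hu => ?_⟩
  have hn0 := Nat.one_le_iff_ne_zero.1 hn
  exact (WAK.securityDelta_le hP hn0 g hK hS hQ hu).trans (hbound n hn0)
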